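/- Let $\mu$ be a finite positive Borel measure on the unit circle $\Gamma$ that is nontrivial (not carried by a finite set). For $n\ge 0$ let $\Phi_n$ be its monic orthogonal polynomial of degree $n$, determined by $\int_\Gamma \Phi_n(z)\,z^{-k}\,d\mu(z)=0$ for $0\le k\le n-1$; let $\alpha_n=-\overline{\Phi_{n+1}(0)}$ be its Verblunsky coefficients, and put $S(z)=-\sum_{n\ge 1}\alpha_{n-1}z^n$. Write $d\mu=w\,\frac{|dz|}{2\pi}+d\mu_s$ with $d\mu_s$ singular, and let $$D_i(z)=\exp\Big(\frac1{4\pi}\int_0^{2\pi}\log w(e^{i\theta})\,\frac{e^{i\theta}+z}{e^{i\theta}-z}\,d\theta\Big),\qquad |z|<1,$$ be the interior Szegő function. Suppose that $\limsup_{n\to\infty}|\alpha_n|^{1/n}=R^{-1}<1$, where $1<R\le\infty$ (with $\infty^{-1}=0$). Then $w>0$ almost everywhere and $\log w$ is integrable on $\Gamma$ (so that $D_i$ is well defined); the series $S$ converges and is analytic in $\{|z|<R\}$; and $D_i^{-1}$ continues analytically to $\{|z|<R\}$. Moreover there is a $\delta\in(0,1)$ such that $D_i$ continues analytically to $\{|z|<(1-\delta)^{-1}\}$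 and, with these continuations, the function $$\overline{D_i(1/\bar z)}\,D_i(z)^{-1}-S(z),$$ defined for $1-\delta<|z|<R$, has an analytic continuation to the annulus $\{z\in\mathbb C: 1-\delta<|z|<R^3\}$ (to $\{|z|>1-\delta\}$ if $R=\infty$). -/

import Mathlib

open MeasureTheory Filter Polynomial
open scoped ENNReal ComplexConjugate

noncomputable section

/-- The unit circle carries its Borel `σ`-algebra. -/
instance instMeasurableSpaceCircle : MeasurableSpace Circle := borel Circle

instance instBorelSpaceCircle : BorelSpace Circle := ⟨rfl⟩

/-- Normalized arc length `|dz| / 2π` on the unit circle. -/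
def arcMeasure : Measure Circle :=
  (ENNReal.ofReal (2 * Real.pi))⁻¹ •
    (volume.restrict (Set.Ioc 0 (2 * Real.pi))).map Circle.exp

instance instIsProbabilityMeasureArcMeasure : IsProbabilityMeasure arcMeasure := by
  constructor
  have h : ENNReal.ofReal (2 * Real.pi) ≠ 0 := by
    simpa using Real.pi_pos
  rw [arcMeasure, Measure.smul_apply,
    Measure.map_apply Circle.exp.continuous.measurable MeasurableSet.univ]
  simpa using ENNReal.inv_mul_cancel h ENNReal.ofReal_ne_top

/-- A measure on the circle is nontrivial if it is not carried by a finite set. -/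
def IsNontrivialMeasure (μ : Measure Circle) : Prop :=
  ∀ s : Set Circle, s.Finite → μ sᶜ ≠ 0

/-- `P` is the monic polynomial `z ^ n + ⋯` of degree `n` that is orthogonal to
`1, z, …, z ^ (n - 1)` in `L²(μ)` (note that `z ^ (-k)` is the conjugate of `z ^ k` on the
circle). -/
def IsMonicOPUC (μ : Measure Circle) (n : ℕ) (P : ℂ[X]) : Prop :=
  P.Monic ∧ P.natDegree = n ∧
    ∀ k < n, ∫ z : Circle, P.eval (z : ℂ) * (z : ℂ) ^ (-(k : ℤ)) ∂μ = 0

open Classical in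
/-- The monic orthogonal polynomial `Φ_n` of `μ`. -/
def monicOPUC (μ : Measure Circle) (n : ℕ) : ℂ[X] :=
  if h : ∃ P, IsMonicOPUC μ n P then h.choose else 0

theorem continuous_coe_circle : Continuous (fun z : Circle => (z : ℂ)) :=
  continuous_subtype_val

theorem integrable_eval_mul_zpow (μ : Measure Circle) [IsFiniteMeasure μ] (P : ℂ[X]) (k : ℕ) :
    Integrable (fun z : Circle => P.eval (z : ℂ) * (z : ℂ) ^ (-(k : ℤ))) μ := by
  have hc : Continuous (fun z : Circle => P.eval (z : ℂ) * (z : ℂ) ^ (-(k : ℤ))) := by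
    refine (P.continuous.comp continuous_coe_circle).mul ?_
    exact continuous_coe_circle.zpow₀ _ fun z => Or.inl z.coe_ne_zero
  exact hc.integrable_of_hasCompactSupport (HasCompactSupport.of_compactSpace _)

/-- For a nontrivial measure, a polynomial of degree `< n` orthogonal to
`1, z, …, z ^ (n - 1)` vanishes. -/
theorem eq_zero_of_orthogonal {μ : Measure Circle} [IsFiniteMeasure μ]
    (hμ : IsNontrivialMeasure μ) {n : ℕ} {P : ℂ[X]} (hP : P.degree < n)
    (h : ∀ k < n, ∫ z : Circle, P.eval (z : ℂ) * (z : ℂ) ^ (-(k : ℤ)) ∂μ = 0) : P = 0 := by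
  by_contra hne
  have key : ∀ z : Circle, ((‖P.eval (z : ℂ)‖ ^ 2 : ℝ) : ℂ) =
      ∑ k ∈ Finset.range n, conj (P.coeff k) * (P.eval (z : ℂ) * (z : ℂ) ^ (-(k : ℤ))) := by
    intro z
    have hn : P.natDegree < n := (natDegree_lt_iff_degree_lt hne).2 hP
    have h1 : conj (P.eval (z : ℂ)) =
        ∑ k ∈ Finset.range n, conj (P.coeff k) * (z : ℂ) ^ (-(k : ℤ)) := by
      rw [eval_eq_sum_range' hn, map_sum]
      refine Finset.sum_congr rfl fun k _ => ?_
      rw [map_mul, map_pow, ← Circle.coe_inv_eq_conj, zpow_neg, zpow_natCast, Circle.coe_inv,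
        inv_pow]
    have h2 : ((‖P.eval (z : ℂ)‖ ^ 2 : ℝ) : ℂ) = P.eval (z : ℂ) * conj (P.eval (z : ℂ)) := by
      rw [Complex.mul_conj, Complex.normSq_eq_norm_sq]
    rw [h2, h1, Finset.mul_sum]
    exact Finset.sum_congr rfl fun k _ => by ring
  have h0 : ∫ z : Circle, ‖P.eval (z : ℂ)‖ ^ 2 ∂μ = 0 := by
    have : ∫ z : Circle, ((‖P.eval (z : ℂ)‖ ^ 2 : ℝ) : ℂ) ∂μ = 0 := by
      simp_rw [key]
      rw [integral_finsetSum _ fun k _ => (integrable_eval_mul_zpow μ P k).const_mul _]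
      refine Finset.sum_eq_zero fun k hk => ?_
      rw [integral_const_mul, h k (Finset.mem_range.1 hk), mul_zero]
    rw [integral_complex_ofReal] at this
    exact_mod_cast this
  have hc : Continuous (fun z : Circle => ‖P.eval (z : ℂ)‖ ^ 2) :=
    ((P.continuous.comp continuous_coe_circle).norm).pow 2
  have hae := (integral_eq_zero_iff_of_nonneg (fun z => by positivity)
    (hc.integrable_of_hasCompactSupport (HasCompactSupport.of_compactSpace _))).1 h0
  refine hμ ((fun z : Circle => (z : ℂ)) ⁻¹' {x | P.IsRoot x})
    ((P.finite_setOfPred_isRoot hne).preimage Circle.coe_injective.injOn) ?_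
  refine measure_mono_null ?_ hae
  intro z hz
  simpa [IsRoot] using hz

/-- Existence and uniqueness of the monic orthogonal polynomials of a nontrivial measure. -/
theorem existsUnique_isMonicOPUC {μ : Measure Circle} [IsFiniteMeasure μ]
    (hμ : IsNontrivialMeasure μ) (n : ℕ) : ∃! P, IsMonicOPUC μ n P := by
  let L : degreeLT ℂ n →ₗ[ℂ] (Fin n → ℂ) :=
    { toFun := fun P k => ∫ z : Circle, (P : ℂ[X]).eval (z : ℂ) * (z : ℂ) ^ (-((k : ℕ) : ℤ)) ∂μ
      map_add' := fun P Q => by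
        ext k
        simp only [Submodule.coe_add, eval_add, add_mul, Pi.add_apply]
        exact integral_add (integrable_eval_mul_zpow μ _ _) (integrable_eval_mul_zpow μ _ _)
      map_smul' := fun c P => by
        ext k
        simp only [Submodule.coe_smul, eval_smul, smul_eq_mul, mul_assoc, Pi.smul_apply,
          RingHom.id_apply]
        exact integral_const_mul _ _ }
  have hinj : Function.Injective L := by
    rw [← LinearMap.ker_eq_bot, LinearMap.ker_eq_bot']
    intro P hP
    exact Subtype.ext (eq_zero_of_orthogonal hμ (mem_degreeLT.1 P.2)
      fun k hk => congrFun hP ⟨k, hk⟩)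
  have : FiniteDimensional ℂ (degreeLT ℂ n) := (degreeLTEquiv ℂ n).symm.finiteDimensional
  have hsurj : Function.Surjective L :=
    (LinearMap.injective_iff_surjective_of_finrank_eq_finrank
      (LinearEquiv.finrank_eq (degreeLTEquiv ℂ n))).1 hinj
  obtain ⟨Q, hQ⟩ := hsurj fun k =>
    ∫ z : Circle, (X ^ n : ℂ[X]).eval (z : ℂ) * (z : ℂ) ^ (-((k : ℕ) : ℤ)) ∂μ
  have hq : ∀ k < n, ∫ z : Circle, (Q : ℂ[X]).eval (z : ℂ) * (z : ℂ) ^ (-(k : ℤ)) ∂μ =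
      ∫ z : Circle, (X ^ n : ℂ[X]).eval (z : ℂ) * (z : ℂ) ^ (-(k : ℤ)) ∂μ :=
    fun k hk => congrFun hQ ⟨k, hk⟩
  have hQd : (Q : ℂ[X]).degree < (n : WithBot ℕ) := mem_degreeLT.1 Q.2
  generalize (Q : ℂ[X]) = q at hq hQd
  refine ⟨X ^ n - q, ⟨monic_X_pow_sub hQd, natDegree_eq_of_degree_eq_some ?_, fun k hk => ?_⟩, ?_⟩
  · exact (degree_sub_eq_left_of_degree_lt (by simpa only [degree_X_pow] using hQd)).trans (degree_X_pow n)
  · have := hq k hk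
    simp only [eval_sub, sub_mul]
    rw [integral_sub (integrable_eval_mul_zpow μ _ _) (integrable_eval_mul_zpow μ _ _), sub_eq_zero]
    exact this.symm
  · rintro P ⟨hPm, hPd, hP⟩
    have hd : (P - (X ^ n - q)).degree < (n : WithBot ℕ) := by
      have h1 : (P - X ^ n).degree < (n : WithBot ℕ) := by
        have hPd' : P.degree = n := by rw [degree_eq_natDegree hPm.ne_zero, hPd]
        rw [← hPd']
        exact degree_sub_lt_left (by simp [hPd']) hPm.ne_zero (by simp [hPm.leadingCoeff])
      have : P - (X ^ n - q) = (P - X ^ n) + q := by ring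
      rw [this]
      exact (degree_add_le _ _).trans_lt (max_lt h1 hQd)
    refine sub_eq_zero.1 (eq_zero_of_orthogonal hμ hd fun k hk => ?_)
    have := hq k hk
    simp only [eval_sub, sub_mul] at this ⊢
    rw [integral_sub (integrable_eval_mul_zpow μ _ _), hP k hk, integral_sub
      (integrable_eval_mul_zpow μ _ _) (integrable_eval_mul_zpow μ _ _), ← this, zero_sub,
      neg_eq_zero]
    · exact sub_self _
    · exact (integrable_eval_mul_zpow μ _ k).sub (integrable_eval_mul_zpow μ _ k)

theorem monicOPUC_spec {μ : Measure Circle} [IsFiniteMeasure μ]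
    (hμ : IsNontrivialMeasure μ) (n : ℕ) : IsMonicOPUC μ n (monicOPUC μ n) := by
  have h := (existsUnique_isMonicOPUC hμ n).exists
  rw [monicOPUC, dif_pos h]
  exact h.choose_spec

/-- The Verblunsky coefficients `α_n = - conj (Φ_{n+1}(0))`. -/
def verblunsky (μ : Measure Circle) (n : ℕ) : ℂ :=
  -conj ((monicOPUC μ (n + 1)).eval 0)

/-- The function `S(z) = - ∑_{n ≥ 1} α_{n-1} z ^ n`. -/
def verblunskySeries (μ : Measure Circle) (z : ℂ) : ℂ :=
  -∑' n : ℕ, verblunsky μ n * z ^ (n + 1)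

/-- The weight `w` of `μ`: the density, with respect to `|dz| / 2π`, of its absolutely continuous
part. -/
def weight (μ : Measure Circle) (ζ : Circle) : ℝ :=
  (μ.rnDeriv arcMeasure ζ).toReal

/-- The Szegő condition `∫ log w > -∞`. As `Real.log 0 = 0`, the positivity of `w` almost
everywhere has to be stated. -/
def SzegoCondition (μ : Measure Circle) : Prop :=
  (∀ᵐ ζ ∂arcMeasure, 0 < weight μ ζ) ∧
    Integrable (fun ζ => Real.log (weight μ ζ)) arcMeasure

/-- The Szegő function `D` of `μ`, off the unit circle. -/
def szegoFunction (μ : Measure Circle) (z : ℂ) : ℂ :=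
  Complex.exp ((1 / (4 * (Real.pi : ℂ))) *
    ∫ θ in (0 : ℝ)..(2 * Real.pi), (Real.log (weight μ (Circle.exp θ)) : ℂ) *
      (((Circle.exp θ : ℂ) + z) / ((Circle.exp θ : ℂ) - z)))

end

/-! ### Measures on the circle -/

/-! Put ρ₀ = 1/R. The reversed polynomials Φ_n^* satisfy Φ_n^* = 1 - ∑_{j<n} α_j z Φ_j, and |Φ_j| is
at most a constant times max(1,|z|)^j, so they converge on |z| < R to an analytic G (`szegoLimit`).
Since ∑|α_n| < ∞ and |α_n| < 1, a product bound keeps G away from 0 on the closed disc.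

Orthogonality passes to the limit: |G|²μ has vanishing nonzero Fourier coefficients, so it is κ
times arc length and w = κ/|G|² (`weight_ae_eq_szegoLimit`). The Schwarz formula applied to a
logarithm of G gives D_i = √κ/G (`szegoFunction_eq_div`). With G♯(z) = conj G(1/conj z), the
function to be continued is therefore G/G♯ - S.

Summation by parts in the recursion (`szegoRev_sub_eq_sum`) gives, with S_m(z) = ∑_{j≤m} α_j
z^{j+1}, the limit identity G - S G♯ = 1 - ∑_m S_m(z) conj(α_m) z^{-m-1} Φ_m^*(z). Beyond |z| = R
each of S_m(z) z^{-m-1} and α_m decays roughly like R^{-m}, while Φ_m^*(z) grows roughly like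
(|z|/R)^m, so the series converges up to |z| = R³. Division by G♯, which has no zeros in |z| > 1 -
δ, finishes the proof. -/

theorem integral_arcMeasure {f : Circle → ℂ} (hf : Continuous f) :
    ∫ ζ, f ζ ∂arcMeasure =
      (2 * (Real.pi : ℂ))⁻¹ * ∫ θ in (0 : ℝ)..(2 * Real.pi), f (Circle.exp θ) := by
  rw [arcMeasure, integral_smul_measure,
    integral_map Circle.exp.continuous.aemeasurable hf.aestronglyMeasurable,
    intervalIntegral.integral_of_le Real.two_pi_pos.le, ENNReal.toReal_inv,
    ENNReal.toReal_ofReal Real.two_pi_pos.le, Complex.real_smul]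
  push_cast
  rfl

theorem ae_restrict_of_ae_arcMeasure {p : Circle → Prop} (h : ∀ᵐ ζ ∂arcMeasure, p ζ) :
    ∀ᵐ θ ∂(volume.restrict (Set.Ioc 0 (2 * Real.pi))), p (Circle.exp θ) := by
  rw [arcMeasure, Measure.ae_ennreal_smul_measure_iff
    (ENNReal.inv_ne_zero.2 ENNReal.ofReal_ne_top)] at h
  exact ae_of_ae_map Circle.exp.continuous.aemeasurable h

theorem circleAverage_zero_one_eq (f : ℂ → ℂ) :
    Real.circleAverage f 0 1 =
      (2 * (Real.pi : ℂ))⁻¹ * ∫ θ in (0 : ℝ)..(2 * Real.pi), f (Circle.exp θ) := by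
  rw [Real.circleAverage_def, Complex.real_smul]
  simp [circleMap, Circle.coe_exp]

theorem integral_zpow_arcMeasure (k : ℤ) :
    ∫ ζ : Circle, (ζ : ℂ) ^ k ∂arcMeasure = if k = 0 then 1 else 0 := by
  split_ifs with hk
  · simp [hk]
  have hc : Continuous fun ζ : Circle => (ζ : ℂ) ^ k :=
    continuous_coe_circle.zpow₀ _ fun z => Or.inl z.coe_ne_zero
  rw [integral_arcMeasure hc]
  have h : ∫ θ in (0 : ℝ)..(2 * Real.pi), Complex.exp ((k * Complex.I) * (θ : ℂ)) = 0 := by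
    rw [integral_exp_mul_complex (by simpa using hk)]
    have : Complex.exp (k * Complex.I * ((2 * Real.pi : ℝ) : ℂ)) = 1 :=
      Complex.exp_eq_one_iff.2 ⟨k, by push_cast; ring⟩
    rw [this]
    simp
  rw [mul_eq_zero]
  right
  rw [← h]
  refine intervalIntegral.integral_congr fun θ _ => ?_
  simp only [Circle.coe_exp]
  rw [← Complex.exp_int_mul]
  ring_nf

/-- A finite measure on the circle is determined by its Fourier coefficients. -/
theorem measure_circle_ext_of_integral_zpow {μ ν : Measure Circle} [IsFiniteMeasure μ]
    [IsFiniteMeasure ν]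
    (h : ∀ k : ℤ, ∫ ζ : Circle, (ζ : ℂ) ^ k ∂μ = ∫ ζ : Circle, (ζ : ℂ) ^ k ∂ν) : μ = ν := by
  let u : BoundedContinuousFunction Circle ℂ :=
    BoundedContinuousFunction.mkOfCompact ⟨fun ζ => (ζ : ℂ), continuous_coe_circle⟩
  have hu : ∀ ζ, u ζ = ζ := fun _ => rfl
  refine ext_of_forall_mem_subalgebra_integral_eq_of_polish (𝕜 := ℂ)
    (A := StarAlgebra.adjoin ℂ {u}) ?_ ?_
  · intro x y hxy
    refine ⟨fun ζ => (ζ : ℂ), ⟨_, ⟨u, StarAlgebra.subset_adjoin ℂ _ (Set.mem_singleton _), rfl⟩, rfl⟩,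
      fun hh => hxy (Circle.coe_injective hh)⟩
  · intro g hg
    have hg' : g ∈ Submodule.span ℂ
        (Submonoid.closure ({u} ∪ star {u}) : Set (BoundedContinuousFunction Circle ℂ)) := by
      rw [← Algebra.adjoin_eq_span]
      exact hg
    -- On the circle `star u` is the inverse of `u`, so the monomials in `u` and `star u` are the
    -- integer powers of the coordinate, and these span the algebra.
    have hpow : ∀ x ∈ Submonoid.closure ({u} ∪ star {u} : Set (BoundedContinuousFunction Circle ℂ)),
        ∃ k : ℤ, ∀ ζ : Circle, x ζ = (ζ : ℂ) ^ k := by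
      intro x hx
      induction hx using Submonoid.closure_induction with
      | mem x hx =>
        rcases hx with hx | hx
        · refine ⟨1, fun ζ => ?_⟩
          rw [Set.mem_singleton_iff.1 hx, zpow_one, hu]
        · refine ⟨-1, fun ζ => ?_⟩
          rw [Set.star_singleton, Set.mem_singleton_iff] at hx
          rw [hx, zpow_neg_one, ← Circle.coe_inv, Circle.coe_inv_eq_conj]
          rfl
      | one => exact ⟨0, fun ζ => by simp⟩
      | mul x y _ _ ihx ihy =>
        obtain ⟨k, hk⟩ := ihx
        obtain ⟨l, hl⟩ := ihy
        exact ⟨k + l, fun ζ => by rw [zpow_add₀ ζ.coe_ne_zero, ← hk, ← hl]; rfl⟩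
    clear hg
    induction hg' using Submodule.span_induction with
    | mem x hx =>
      obtain ⟨k, hk⟩ := hpow x hx
      simp_rw [hk]
      exact h k
    | zero => simp
    | add x y _ _ ihx ihy =>
      simp only [BoundedContinuousFunction.coe_add, Pi.add_apply]
      rw [integral_add (x.integrable _) (y.integrable _),
        integral_add (x.integrable _) (y.integrable _), ihx, ihy]
    | smul c x _ ih =>
      simp only [BoundedContinuousFunction.coe_smul]
      rw [integral_smul, integral_smul, ih]

theorem Continuous.integrable_circle {E : Type*} [NormedAddCommGroup E] {f : Circle → E}
    (hf : Continuous f) (μ : Measure Circle) [IsFiniteMeasure μ] : Integrable f μ :=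
  hf.integrable_of_hasCompactSupport (HasCompactSupport.of_compactSpace _)

/-! ### The Szegő recursion -/

/-- The pair `(Φ_n, Φ_n^*)` generated by the Szegő recursion with coefficients `α`. -/
noncomputable def szegoPair (α : ℕ → ℂ) : ℕ → ℂ[X] × ℂ[X]
  | 0 => (1, 1)
  | n + 1 => (X * (szegoPair α n).1 - C (conj (α n)) * (szegoPair α n).2,
      (szegoPair α n).2 - C (α n) * (X * (szegoPair α n).1))

/-- The polynomial `Φ_n` of the Szegő recursion. -/
noncomputable def szegoPoly (α : ℕ → ℂ) (n : ℕ) : ℂ[X] := (szegoPair α n).1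

/-- The reversed polynomial `Φ_n^*` of the Szegő recursion. -/
noncomputable def szegoRev (α : ℕ → ℂ) (n : ℕ) : ℂ[X] := (szegoPair α n).2

section Recursion

variable (α : ℕ → ℂ)

@[simp] theorem szegoPoly_zero : szegoPoly α 0 = 1 := rfl

@[simp] theorem szegoRev_zero : szegoRev α 0 = 1 := rfl

theorem szegoPoly_succ (n : ℕ) :
    szegoPoly α (n + 1) = X * szegoPoly α n - C (conj (α n)) * szegoRev α n := rfl

theorem szegoRev_succ (n : ℕ) :
    szegoRev α (n + 1) = szegoRev α n - C (α n) * (X * szegoPoly α n) := rfl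

theorem eval_szegoPoly_succ (n : ℕ) (z : ℂ) : (szegoPoly α (n + 1)).eval z =
    z * (szegoPoly α n).eval z - conj (α n) * (szegoRev α n).eval z := by
  simp [szegoPoly_succ]

theorem eval_szegoRev_succ (n : ℕ) (z : ℂ) : (szegoRev α (n + 1)).eval z =
    (szegoRev α n).eval z - α n * (z * (szegoPoly α n).eval z) := by
  simp [szegoRev_succ]

theorem eval_zero_szegoRev (n : ℕ) : (szegoRev α n).eval 0 = 1 := by
  induction n with
  | zero => simp
  | succ n ih => simp [eval_szegoRev_succ, ih]

theorem natDegree_szego_le (n : ℕ) :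
    (szegoPoly α n).natDegree ≤ n ∧ (szegoRev α n).natDegree ≤ n := by
  induction n with
  | zero => simp
  | succ n ih =>
    have hX : (X * szegoPoly α n).natDegree ≤ n + 1 :=
      natDegree_mul_le.trans (by rw [natDegree_X]; omega)
    refine ⟨?_, ?_⟩
    · rw [szegoPoly_succ]
      exact (natDegree_sub_le_of_le hX
        ((natDegree_C_mul_le _ _).trans (ih.2.trans n.le_succ))).trans (max_le le_rfl le_rfl)
    · rw [szegoRev_succ]
      exact (natDegree_sub_le_of_le (ih.2.trans n.le_succ)
        ((natDegree_C_mul_le _ _).trans hX)).trans (max_le le_rfl le_rfl)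

/-- Each of `Φ_n` and `Φ_n^*` is the reversal of the other. -/
theorem szego_reversal (n : ℕ) {z : ℂ} (hz : z ≠ 0) :
    (szegoPoly α n).eval z = z ^ n * conj ((szegoRev α n).eval (conj z)⁻¹) ∧
    (szegoRev α n).eval z = z ^ n * conj ((szegoPoly α n).eval (conj z)⁻¹) := by
  induction n with
  | zero => simp
  | succ n ih =>
    rw [eval_szegoPoly_succ, eval_szegoRev_succ, eval_szegoPoly_succ, eval_szegoRev_succ]
    simp only [map_sub, map_mul, map_inv₀, Complex.conj_conj]
    rw [ih.1, ih.2]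
    generalize conj ((szegoRev α n).eval (conj z)⁻¹) = a
    generalize conj ((szegoPoly α n).eval (conj z)⁻¹) = b
    have h1 : z ^ (n + 1) * z⁻¹ = z ^ n := by rw [pow_succ, mul_inv_cancel_right₀ hz]
    constructor
    · linear_combination conj (α n) * b * h1
    · linear_combination -b * h1

theorem conj_eval_szegoPoly_circle (n : ℕ) (z : Circle) :
    conj ((szegoPoly α n).eval (z : ℂ)) = (z : ℂ) ^ (-(n : ℤ)) * (szegoRev α n).eval (z : ℂ) := by
  have h := (szego_reversal α n z.coe_ne_zero).2
  rw [← Circle.coe_inv_eq_conj, Circle.coe_inv, inv_inv] at h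
  rw [h, zpow_neg, zpow_natCast, inv_mul_cancel_left₀ (pow_ne_zero _ z.coe_ne_zero)]

/-- In the closed unit disc `|Φ_n| ≤ |Φ_n^*|`. -/
theorem norm_szegoPoly_le (hα : ∀ n, ‖α n‖ ≤ 1) {z : ℂ} (hz : ‖z‖ ≤ 1) (n : ℕ) :
    ‖(szegoPoly α n).eval z‖ ≤ ‖(szegoRev α n).eval z‖ := by
  -- Division-free form of the fact that w ↦ (w - conj c)/(1 - c w) maps the closed disc to itself
  -- when |c| < 1, applied to w = z Φ_n/Φ_n^*.
  have key : ∀ a b c : ℂ, ‖c‖ ≤ 1 → ‖a‖ ≤ ‖b‖ → ‖a - conj c * b‖ ≤ ‖b - c * a‖ := by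
    intro a b c hc hab
    refine abs_le_of_sq_le_sq' ?_ (norm_nonneg _) |>.2
    have hc2 : ‖c‖ ^ 2 ≤ 1 := pow_le_one₀ (norm_nonneg _) hc
    have hab2 : ‖a‖ ^ 2 ≤ ‖b‖ ^ 2 := pow_le_pow_left₀ (norm_nonneg _) hab 2
    have hid : ‖b - c * a‖ ^ 2 - ‖a - conj c * b‖ ^ 2 = (‖b‖ ^ 2 - ‖a‖ ^ 2) * (1 - ‖c‖ ^ 2) := by
      simp only [Complex.sq_norm, Complex.normSq_apply, Complex.sub_re, Complex.sub_im,
        Complex.mul_re, Complex.mul_im, Complex.conj_re, Complex.conj_im]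
      ring
    nlinarith [mul_nonneg (sub_nonneg.2 hab2) (sub_nonneg.2 hc2)]
  induction n with
  | zero => simp
  | succ n ih =>
    rw [eval_szegoPoly_succ, eval_szegoRev_succ]
    refine key _ _ _ (hα n) ?_
    rw [norm_mul]
    exact (mul_le_of_le_one_left (norm_nonneg _) hz).trans ih

/-- As |Φ_n| ≤ |Φ_n^*| on the closed disc, one step of the recursion shrinks |Φ_n^*| by a factor of
at least 1 - |α_n|. This is the source of the zero-freeness of the limit. -/
theorem prod_le_norm_szegoRev (hα : ∀ n, ‖α n‖ ≤ 1) {z : ℂ} (hz : ‖z‖ ≤ 1) (n : ℕ) :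
    ∏ j ∈ Finset.range n, (1 - ‖α j‖) ≤ ‖(szegoRev α n).eval z‖ := by
  induction n with
  | zero => simp
  | succ n ih =>
    rw [Finset.prod_range_succ, eval_szegoRev_succ]
    have h1 : ‖α n * (z * (szegoPoly α n).eval z)‖ ≤ ‖α n‖ * ‖(szegoRev α n).eval z‖ := by
      rw [norm_mul, norm_mul]
      gcongr
      exact (mul_le_of_le_one_left (norm_nonneg _) hz).trans (norm_szegoPoly_le α hα hz n)
    have h2 := norm_sub_norm_le ((szegoRev α n).eval z) (α n * (z * (szegoPoly α n).eval z))
    nlinarith [mul_le_mul_of_nonneg_right ih (sub_nonneg.2 (hα n))]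

/-- A crude common bound: for s ≥ 1 each step costs at most the factor s(1 + |α_n|). The order s^n
is adequate for Φ_n; for Φ_n^* it is improved later. -/
theorem norm_szego_le (n : ℕ) {z : ℂ} {s : ℝ} (hs : 1 ≤ s) (hz : ‖z‖ ≤ s) :
    ‖(szegoPoly α n).eval z‖ ≤ (∏ j ∈ Finset.range n, (1 + ‖α j‖)) * s ^ n ∧
    ‖(szegoRev α n).eval z‖ ≤ (∏ j ∈ Finset.range n, (1 + ‖α j‖)) * s ^ n := by
  induction n with
  | zero => simp
  | succ n ih =>
    set B := (∏ j ∈ Finset.range n, (1 + ‖α j‖)) * s ^ n with hB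
    have hB0 : 0 ≤ B := (norm_nonneg _).trans ih.1
    have hsB : B ≤ s * B := le_mul_of_one_le_left hB0 hs
    have hfin : (∏ j ∈ Finset.range (n + 1), (1 + ‖α j‖)) * s ^ (n + 1) =
        s * B + ‖α n‖ * (s * B) := by
      rw [Finset.prod_range_succ, hB]; ring
    have hzP : ‖z * (szegoPoly α n).eval z‖ ≤ s * B := by
      rw [norm_mul]
      exact mul_le_mul hz ih.1 (norm_nonneg _) (by linarith)
    rw [hfin, eval_szegoPoly_succ, eval_szegoRev_succ]
    constructor
    · refine (norm_sub_le _ _).trans (add_le_add hzP ?_)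
      rw [norm_mul, RCLike.norm_conj]
      exact mul_le_mul_of_nonneg_left (ih.2.trans hsB) (norm_nonneg _)
    · refine (norm_sub_le _ _).trans (add_le_add (ih.2.trans hsB) ?_)
      rw [norm_mul]
      exact mul_le_mul_of_nonneg_left hzP (norm_nonneg _)

theorem eval_szegoRev_eq_sum (n : ℕ) (z : ℂ) : (szegoRev α n).eval z =
    1 - ∑ j ∈ Finset.range n, α j * (z * (szegoPoly α j).eval z) := by
  induction n with
  | zero => simp
  | succ n ih => rw [eval_szegoRev_succ, Finset.sum_range_succ, ih]; ring

/-- Summation by parts in the Szegő recursion. -/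
theorem szegoRev_sub_eq_sum (n : ℕ) {z : ℂ} (hz : z ≠ 0) :
    (szegoRev α n).eval z + (∑ j ∈ Finset.range n, α j * z ^ (j + 1)) *
        conj ((szegoRev α n).eval (conj z)⁻¹) =
      1 - ∑ m ∈ Finset.range n, (∑ j ∈ Finset.range (m + 1), α j * z ^ (j + 1)) *
        (conj (α m) * ((z ^ (m + 1))⁻¹ * (szegoRev α m).eval z)) := by
  induction n with
  | zero => simp
  | succ n ih =>
    -- By reversal, the increment -α_n z Φ_n(z) of Φ_n^*(z) cancels the new term of the partial sum
    -- times conj Φ_n^*(1/conj z). What is left is the partial sum, new term included, times the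
    -- increment of the reflected factor, which is -conj(α_n) z^{-n-1} Φ_n^*(z).
    rw [Finset.sum_range_succ (fun m => (∑ j ∈ Finset.range (m + 1), α j * z ^ (j + 1)) *
        (conj (α m) * ((z ^ (m + 1))⁻¹ * (szegoRev α m).eval z))), ← sub_sub, ← ih,
      eval_szegoRev_succ, eval_szegoRev_succ, (szego_reversal α n hz).1,
      (szego_reversal α n hz).2, Finset.sum_range_succ]
    simp only [map_sub, map_mul, map_inv₀, Complex.conj_conj]
    field_simp
    ring

end Recursion

/-! ### Orthogonality -/

theorem conj_eval_circle_eq_sum {q : ℂ[X]} {n : ℕ} (hq : q.natDegree ≤ n) (z : Circle) :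
    conj (q.eval (z : ℂ)) = ∑ k ∈ Finset.range (n + 1), conj (q.coeff k) * (z : ℂ) ^ (-(k : ℤ)) := by
  rw [eval_eq_sum_range' (Nat.lt_succ_of_le hq), map_sum]
  refine Finset.sum_congr rfl fun k _ => ?_
  rw [map_mul, map_pow, ← Circle.coe_inv_eq_conj, zpow_neg, zpow_natCast, Circle.coe_inv, inv_pow]

/-- A function orthogonal to `z, …, z ^ n` pairs with a polynomial `q` of degree at most `n`
through `q 0`. -/
theorem integral_mul_conj_eval {μ : Measure Circle} [IsFiniteMeasure μ] {f : Circle → ℂ}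
    (hf : Continuous f) {q : ℂ[X]} {n : ℕ} (hq : q.natDegree ≤ n)
    (h : ∀ k : ℕ, 1 ≤ k → k ≤ n → ∫ z : Circle, f z * (z : ℂ) ^ (-(k : ℤ)) ∂μ = 0) :
    ∫ z : Circle, f z * conj (q.eval (z : ℂ)) ∂μ = conj (q.eval 0) * ∫ z, f z ∂μ := by
  have hint : ∀ k : ℕ, Integrable (fun z : Circle => conj (q.coeff k) *
      (f z * (z : ℂ) ^ (-(k : ℤ)))) μ := fun k =>
    (continuous_const.mul (hf.mul
      (continuous_coe_circle.zpow₀ _ fun z => Or.inl z.coe_ne_zero))).integrable_circle μ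
  have h1 : ∀ z : Circle, f z * conj (q.eval (z : ℂ)) = ∑ k ∈ Finset.range (n + 1),
      conj (q.coeff k) * (f z * (z : ℂ) ^ (-(k : ℤ))) := fun z => by
    rw [conj_eval_circle_eq_sum hq, Finset.mul_sum]
    exact Finset.sum_congr rfl fun k _ => by ring
  simp_rw [h1]
  rw [integral_finsetSum _ fun k _ => hint k, Finset.sum_range_succ', Finset.sum_eq_zero, zero_add,
    integral_const_mul, coeff_zero_eq_eval_zero]
  · simp
  · intro k hk
    rw [integral_const_mul, h (k + 1) (by omega) (by have := Finset.mem_range.1 hk; omega), mul_zero]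

section Orthogonality

/-- Conjugating the orthogonality of Φ_n to z^{n-k} and using conj Φ_n = z^{-n} Φ_n^* on the circle.
-/
theorem integral_szegoRev_of_isMonicOPUC {μ : Measure Circle} {α : ℕ → ℂ} {n : ℕ}
    (h : IsMonicOPUC μ n (szegoPoly α n)) {k : ℕ} (hk1 : 1 ≤ k) (hkn : k ≤ n) :
    ∫ z : Circle, (szegoRev α n).eval (z : ℂ) * (z : ℂ) ^ (-(k : ℤ)) ∂μ = 0 := by
  have h1 := h.2.2 (n - k) (by omega)
  rw [← map_eq_zero (starRingEnd ℂ), ← integral_conj] at h1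
  rw [← h1]
  refine integral_congr_ae (Eventually.of_forall fun z => ?_)
  have hz : conj (z : ℂ) = (z : ℂ)⁻¹ := by rw [← Circle.coe_inv_eq_conj, Circle.coe_inv]
  have he : (z : ℂ) ^ (-(k : ℤ)) = (z : ℂ) ^ (-(n : ℤ)) * (z : ℂ) ^ ((n - k : ℕ) : ℤ) := by
    rw [← zpow_add₀ z.coe_ne_zero]
    congr 1
    omega
  simp only [map_mul, conj_eval_szegoPoly_circle, map_zpow₀]
  rw [hz, inv_zpow', neg_neg, he]
  ring

variable {μ : Measure Circle} [IsFiniteMeasure μ]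

/-- The difference of the two sides in degree n + 1 vanishes at 0 by the choice of α_n, hence equals
X g with deg g < n. It is orthogonal to z, …, z^n, so g is orthogonal to 1, …, z^{n-1}, and
nontriviality forces g = 0. -/
theorem monicOPUC_eq_szegoPoly (hμ : IsNontrivialMeasure μ) (n : ℕ) :
    monicOPUC μ n = szegoPoly (verblunsky μ) n := by
  induction n with
  | zero =>
    have h := monicOPUC_spec hμ 0
    rw [szegoPoly_zero]
    exact h.1.natDegree_eq_zero.1 h.2.1
  | succ n ih =>
    set α := verblunsky μ with hα
    have hn : IsMonicOPUC μ n (szegoPoly α n) := ih ▸ monicOPUC_spec hμ n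
    obtain ⟨hm, hd, ho⟩ := monicOPUC_spec hμ (n + 1)
    set Φ := monicOPUC μ (n + 1) with hΦ
    have hc : conj (α n) = -Φ.eval 0 := by rw [hα, verblunsky, map_neg, Complex.conj_conj]
    set h := Φ - szegoPoly α (n + 1) with hh
    have h0 : h.eval 0 = 0 := by
      rw [hh, eval_sub, eval_szegoPoly_succ, eval_zero_szegoRev, hc]; ring
    obtain ⟨g, hg⟩ : X ∣ h := by rwa [X_dvd_iff, coeff_zero_eq_eval_zero]
    have hdeg : h.degree < ((n + 1 : ℕ) : WithBot ℕ) := by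
      have h1 : (Φ - X * szegoPoly α n).degree < ((n + 1 : ℕ) : WithBot ℕ) := by
        have hXm : (X * szegoPoly α n).Monic := monic_X.mul hn.1
        have e1 : Φ.degree = ((n + 1 : ℕ) : WithBot ℕ) := by
          rw [degree_eq_natDegree hm.ne_zero, hd]
        have e2 : (X * szegoPoly α n).degree = ((n + 1 : ℕ) : WithBot ℕ) := by
          rw [degree_eq_natDegree hXm.ne_zero, monic_X.natDegree_mul hn.1, hn.2.1, natDegree_X,
            add_comm]
        rw [← e1]
        exact degree_sub_lt_left (by rw [e1, e2]) hm.ne_zero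
          (by rw [hm.leadingCoeff, hXm.leadingCoeff])
      have h2 : (C (conj (α n)) * szegoRev α n).degree < ((n + 1 : ℕ) : WithBot ℕ) :=
        (natDegree_le_iff_degree_le.1
          ((natDegree_C_mul_le _ _).trans (natDegree_szego_le α n).2)).trans_lt
          (by exact_mod_cast Nat.lt_succ_self n)
      have : h = (Φ - X * szegoPoly α n) + C (conj (α n)) * szegoRev α n := by
        rw [hh, szegoPoly_succ]; ring
      rw [this]
      exact (degree_add_le _ _).trans_lt (max_lt h1 h2)
    have hg0 : g = 0 := by
      by_contra hne
      refine hne (eq_zero_of_orthogonal hμ (n := n) ?_ fun k hk => ?_)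
      · have hX : h ≠ 0 := by rw [hg]; exact mul_ne_zero X_ne_zero hne
        have := (natDegree_lt_iff_degree_lt hX).2 hdeg
        rw [hg, natDegree_mul X_ne_zero hne, natDegree_X] at this
        exact (natDegree_lt_iff_degree_lt hne).1 (by omega)
      · have e1 : ∀ z : Circle, g.eval (z : ℂ) * (z : ℂ) ^ (-(k : ℤ)) =
            Φ.eval (z : ℂ) * (z : ℂ) ^ (-((k + 1 : ℕ) : ℤ)) -
            ((szegoPoly α n).eval (z : ℂ) * (z : ℂ) ^ (-(k : ℤ)) -
              conj (α n) * ((szegoRev α n).eval (z : ℂ) * (z : ℂ) ^ (-((k + 1 : ℕ) : ℤ)))) := by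
          intro z
          have hz := z.coe_ne_zero
          have e2 : (z : ℂ) ^ (-(k : ℤ)) = z * (z : ℂ) ^ (-((k + 1 : ℕ) : ℤ)) := by
            rw [← zpow_one_add₀ hz]; congr 1; push_cast; ring
          have e3 : h.eval (z : ℂ) = z * g.eval (z : ℂ) := by rw [hg, eval_mul, eval_X]
          rw [hh, eval_sub, eval_szegoPoly_succ] at e3
          rw [e2]
          linear_combination -(z : ℂ) ^ (-((k + 1 : ℕ) : ℤ)) * e3
        simp_rw [e1]
        have i1 := integrable_eval_mul_zpow μ (szegoPoly α n) k
        have i2 := (integrable_eval_mul_zpow μ (szegoRev α n) (k + 1)).const_mul (conj (α n))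
        have i3 : Integrable (fun z : Circle =>
            (szegoPoly α n).eval (z : ℂ) * (z : ℂ) ^ (-(k : ℤ)) -
            conj (α n) * ((szegoRev α n).eval (z : ℂ) * (z : ℂ) ^ (-((k + 1 : ℕ) : ℤ)))) μ :=
          i1.sub i2
        rw [integral_sub (integrable_eval_mul_zpow μ _ _) i3, integral_sub i1 i2, integral_const_mul, ho _ (by omega),
          hn.2.2 k hk, integral_szegoRev_of_isMonicOPUC hn (by omega) (by omega)]
        simp
    rw [hg0, mul_zero] at hg
    exact sub_eq_zero.1 (hh ▸ hg)

theorem isMonicOPUC_szegoPoly (hμ : IsNontrivialMeasure μ) (n : ℕ) :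
    IsMonicOPUC μ n (szegoPoly (verblunsky μ) n) :=
  monicOPUC_eq_szegoPoly hμ n ▸ monicOPUC_spec hμ n

theorem integral_szegoRev_mul_zpow (hμ : IsNontrivialMeasure μ) {n k : ℕ} (hk1 : 1 ≤ k)
    (hkn : k ≤ n) :
    ∫ z : Circle, (szegoRev (verblunsky μ) n).eval (z : ℂ) * (z : ℂ) ^ (-(k : ℤ)) ∂μ = 0 :=
  integral_szegoRev_of_isMonicOPUC (isMonicOPUC_szegoPoly hμ n) hk1 hkn

/-- In the pairing of Φ_n^* with itself only the constant term 1 of the second factor survives. -/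
theorem integral_norm_sq_szegoRev (hμ : IsNontrivialMeasure μ) (n : ℕ) :
    ((∫ z : Circle, ‖(szegoRev (verblunsky μ) n).eval (z : ℂ)‖ ^ 2 ∂μ : ℝ) : ℂ) =
      ∫ z : Circle, (szegoRev (verblunsky μ) n).eval (z : ℂ) ∂μ := by
  have h := integral_mul_conj_eval (μ := μ)
    ((szegoRev (verblunsky μ) n).continuous.comp continuous_coe_circle)
    (natDegree_szego_le (verblunsky μ) n).2 fun k => integral_szegoRev_mul_zpow hμ
  simp only [Function.comp_apply, eval_zero_szegoRev, map_one, one_mul] at h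
  rw [← h, ← integral_complex_ofReal]
  congr 1
  ext z
  rw [Complex.mul_conj, Complex.normSq_eq_norm_sq]

theorem integral_norm_sq_szegoRev_pos (hμ : IsNontrivialMeasure μ) (n : ℕ) :
    0 < ∫ z : Circle, ‖(szegoRev (verblunsky μ) n).eval (z : ℂ)‖ ^ 2 ∂μ := by
  refine lt_of_le_of_ne (integral_nonneg fun z => by positivity) fun h0 => ?_
  have h1 := integral_norm_sq_szegoRev hμ n
  rw [← h0, Complex.ofReal_zero] at h1
  have h2 : szegoRev (verblunsky μ) n = 0 := by
    refine eq_zero_of_orthogonal hμ (n := n + 1) ?_ fun k hk => ?_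
    · exact (natDegree_le_iff_degree_le.1 (natDegree_szego_le _ n).2).trans_lt
          (by exact_mod_cast Nat.lt_succ_self n)
    · rcases Nat.eq_zero_or_pos k with rfl | hk0
      · simpa using h1.symm
      · exact integral_szegoRev_mul_zpow hμ hk0 (by omega)
  have h3 := eval_zero_szegoRev (verblunsky μ) n
  rw [h2] at h3
  simp at h3

/-- The squared norms satisfy ‖Φ_{n+1}^*‖² = (1 - |α_n|²) ‖Φ_n^*‖², and they are all positive. The
relation comes from integrating the recursion and using that Φ_{n+1} is orthogonal to 1. -/
theorem norm_verblunsky_lt_one (hμ : IsNontrivialMeasure μ) (n : ℕ) : ‖verblunsky μ n‖ < 1 := by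
  set α := verblunsky μ with hα
  have hX : ∫ z : Circle, (z : ℂ) * (szegoPoly α n).eval (z : ℂ) ∂μ =
      conj (α n) * ∫ z : Circle, (szegoRev α n).eval (z : ℂ) ∂μ := by
    have h := (isMonicOPUC_szegoPoly hμ (n + 1)).2.2 0 (by omega)
    simp only [← hα, eval_szegoPoly_succ, Nat.cast_zero, neg_zero, zpow_zero, mul_one] at h
    rw [integral_sub, integral_const_mul, sub_eq_zero] at h
    · exact h
    · exact (continuous_coe_circle.mul
        ((szegoPoly α n).continuous.comp continuous_coe_circle)).integrable_circle μ
    · exact (continuous_const.mul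
        ((szegoRev α n).continuous.comp continuous_coe_circle)).integrable_circle μ
  have hrec : ∫ z : Circle, (szegoRev α (n + 1)).eval (z : ℂ) ∂μ =
      (1 - ‖α n‖ ^ 2) * ∫ z : Circle, (szegoRev α n).eval (z : ℂ) ∂μ := by
    simp only [eval_szegoRev_succ]
    rw [integral_sub, integral_const_mul, hX, ← Complex.mul_conj']
    · ring
    · exact ((szegoRev α n).continuous.comp continuous_coe_circle).integrable_circle μ
    · exact (continuous_const.mul (continuous_coe_circle.mul
        ((szegoPoly α n).continuous.comp continuous_coe_circle))).integrable_circle μ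
  rw [hα, ← integral_norm_sq_szegoRev hμ n, ← integral_norm_sq_szegoRev hμ (n + 1)] at hrec
  have hr := integral_norm_sq_szegoRev_pos hμ n
  have hr' := integral_norm_sq_szegoRev_pos hμ (n + 1)
  have hrec' : (∫ z : Circle, ‖(szegoRev (verblunsky μ) (n + 1)).eval (z : ℂ)‖ ^ 2 ∂μ) =
      (1 - ‖α n‖ ^ 2) * ∫ z : Circle, ‖(szegoRev (verblunsky μ) n).eval (z : ℂ)‖ ^ 2 ∂μ := by
    exact_mod_cast hrec
  rw [hrec'] at hr'
  have := pos_of_mul_pos_left hr' hr.le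
  nlinarith [norm_nonneg (α n)]

end Orthogonality

/-! ### The weight of a measure with an outer orthogonal function -/

/-- If `|G|² μ` has the Fourier coefficients of a multiple of arc length, then the weight of `μ` is
a multiple of `|G|⁻²`. -/
theorem weight_ae_eq_div_norm_sq {μ : Measure Circle} [IsFiniteMeasure μ] {G : Circle → ℂ}
    (hG : Continuous G) (hG0 : ∀ ζ, G ζ ≠ 0)
    (h : ∀ k : ℕ, 1 ≤ k → ∫ ζ : Circle, ((‖G ζ‖ ^ 2 : ℝ) : ℂ) * (ζ : ℂ) ^ (-(k : ℤ)) ∂μ = 0) :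
    weight μ =ᵐ[arcMeasure] fun ζ => (∫ ζ, ‖G ζ‖ ^ 2 ∂μ) / ‖G ζ‖ ^ 2 := by
  set κ := ∫ ζ, ‖G ζ‖ ^ 2 ∂μ with hκ
  have hκ0 : 0 ≤ κ := integral_nonneg fun ζ => by positivity
  have hc : Continuous fun ζ => ‖G ζ‖ ^ 2 := hG.norm.pow 2
  set g : Circle → ℝ≥0∞ := fun ζ => ENNReal.ofReal (‖G ζ‖ ^ 2) with hg
  have hgm : Measurable g := (ENNReal.continuous_ofReal.comp hc).measurable
  have hpos : ∀ ζ, 0 < ‖G ζ‖ ^ 2 := fun ζ => pow_pos (norm_pos_iff.2 (hG0 ζ)) 2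
  have hg0 : ∀ ζ, g ζ ≠ 0 := fun ζ => (ENNReal.ofReal_pos.2 (hpos ζ)).ne'
  have hfin : IsFiniteMeasure (μ.withDensity g) :=
    isFiniteMeasure_withDensity_ofReal (hc.integrable_circle μ).2
  have hfin' : IsFiniteMeasure (ENNReal.ofReal κ • arcMeasure) :=
    Measure.smul_finite _ ENNReal.ofReal_ne_top
  have hint : ∀ f : Circle → ℂ, ∫ ζ, f ζ ∂(μ.withDensity g) =
      ∫ ζ, ((‖G ζ‖ ^ 2 : ℝ) : ℂ) * f ζ ∂μ := fun f => by
    rw [integral_withDensity_eq_integral_toReal_smul hgm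
      (Eventually.of_forall fun ζ => ENNReal.ofReal_lt_top)]
    refine integral_congr_ae (Eventually.of_forall fun ζ => ?_)
    simp only [hg, Complex.real_smul]
    rw [ENNReal.toReal_ofReal (hpos ζ).le]
  have hmul : μ.withDensity g = ENNReal.ofReal κ • arcMeasure := by
    refine measure_circle_ext_of_integral_zpow fun k => ?_
    rw [hint, integral_smul_measure, integral_zpow_arcMeasure, ENNReal.toReal_ofReal hκ0]
    split_ifs with hk
    · simp only [hk, zpow_zero, mul_one]
      rw [integral_complex_ofReal, hκ, Complex.real_smul, mul_one]
    · rw [smul_zero]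
      rcases lt_or_gt_of_ne hk with hk | hk
      · have := h k.natAbs (by omega)
        rwa [show -((k.natAbs : ℕ) : ℤ) = k by omega] at this
      · have := h k.natAbs (by omega)
        rw [← map_eq_zero (starRingEnd ℂ), ← integral_conj] at this
        rw [← this]
        refine integral_congr_ae (Eventually.of_forall fun ζ => ?_)
        have hz : conj (ζ : ℂ) = (ζ : ℂ)⁻¹ := by rw [← Circle.coe_inv_eq_conj, Circle.coe_inv]
        simp only [map_mul, map_zpow₀, Complex.conj_ofReal]
        rw [hz, inv_zpow', neg_neg, show ((k.natAbs : ℕ) : ℤ) = k by omega]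
  have hgi : Measurable fun ζ => (g ζ)⁻¹ := hgm.inv
  -- The density `g` has no zeros, so dividing by it recovers μ, which is thus absolutely
  -- continuous.
  have hμ : μ = arcMeasure.withDensity fun ζ => ENNReal.ofReal (κ / ‖G ζ‖ ^ 2) := by
    rw [← withDensity_inv_same (μ := μ) hgm (Eventually.of_forall hg0)
      (Eventually.of_forall fun ζ => ENNReal.ofReal_ne_top (r := ‖G ζ‖ ^ 2)), hmul,
      withDensity_smul_measure, ← withDensity_smul _ hgi]
    congr 1
    ext ζ
    simp only [Pi.smul_apply, smul_eq_mul, hg]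
    rw [ENNReal.ofReal_div_of_pos (hpos ζ), div_eq_mul_inv]
  have hm : Measurable fun ζ => ENNReal.ofReal (κ / ‖G ζ‖ ^ 2) :=
    (ENNReal.continuous_ofReal.comp
      (continuous_const.div hc fun ζ => (hpos ζ).ne')).measurable
  have := Measure.rnDeriv_withDensity arcMeasure hm
  rw [← hμ] at this
  filter_upwards [this] with ζ hζ
  rw [weight, hζ, ENNReal.toReal_ofReal (div_nonneg hκ0 (hpos ζ).le)]

/-! ### Geometric decay -/

/-- The sequence `α` decays faster than `ρ ^ n` for all `ρ > ρ₀`. -/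
def GeometricDecay (α : ℕ → ℂ) (ρ₀ : ℝ) : Prop :=
  ∀ ρ, ρ₀ < ρ → ∃ C, 0 ≤ C ∧ ∀ n, ‖α n‖ ≤ C * ρ ^ n

theorem exists_gt_mul_lt_one {a b : ℝ} (h : a * b < 1) : ∃ c, b < c ∧ a * c < 1 := by
  have : ∀ᶠ c in nhdsWithin b (Set.Ioi b), a * c < 1 :=
    nhdsWithin_le_nhds ((continuous_const.mul continuous_id).continuousAt.eventually_lt_const h)
  obtain ⟨c, hc, hbc⟩ := (this.and self_mem_nhdsWithin).exists
  exact ⟨c, hbc, hc⟩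

theorem geometricDecay_of_limsup {α : ℕ → ℂ} {r : ℝ≥0∞} (hr : r ≠ ∞)
    (h : limsup (fun n : ℕ => ‖α n‖ₑ ^ (1 / (n : ℝ))) atTop = r) :
    GeometricDecay α r.toReal := by
  intro ρ hρ
  have hρ0 : 0 < ρ := ENNReal.toReal_nonneg.trans_lt hρ
  have hlt : limsup (fun n : ℕ => ‖α n‖ₑ ^ (1 / (n : ℝ))) atTop < ENNReal.ofReal ρ := by
    rw [h]
    exact (ENNReal.lt_ofReal_iff_toReal_lt hr).2 hρ
  -- The index n = 0 is discarded, because there the exponent 1/n is 0 by convention.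
  have hev : ∀ᶠ n in atTop, ‖α n‖ ≤ ρ ^ n := by
    filter_upwards [eventually_lt_of_limsup_lt hlt, eventually_gt_atTop 0] with n hn hn0
    have hn' : (n : ℝ) ≠ 0 := by exact_mod_cast hn0.ne'
    have h1 := ENNReal.rpow_le_rpow hn.le (Nat.cast_nonneg (α := ℝ) n)
    rw [← ENNReal.rpow_mul, one_div_mul_cancel hn', ENNReal.rpow_one, ENNReal.rpow_natCast,
      ← ENNReal.ofReal_pow hρ0.le, ← ofReal_norm] at h1
    exact (ENNReal.ofReal_le_ofReal_iff (by positivity)).1 h1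
  -- Since ρ^n never vanishes, enlarging the constant absorbs the finitely many exceptional indices.
  have hO : (fun n => α n) =O[cofinite] fun n : ℕ => ρ ^ n := by
    rw [Nat.cofinite_eq_atTop]
    refine Asymptotics.IsBigO.of_bound 1 ?_
    filter_upwards [hev] with n hn
    rwa [one_mul, Real.norm_of_nonneg (by positivity)]
  obtain ⟨C, hC, hb⟩ := Asymptotics.bound_of_isBigO_cofinite hO
  refine ⟨C, hC.le, fun n => ?_⟩
  have := hb (x := n) (by positivity)
  rwa [Real.norm_of_nonneg (by positivity)] at this

/-- A locally normally convergent series of analytic functions is analytic. -/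
theorem analyticOnNhd_tsum_of_locally_bounded {f : ℕ → ℂ → ℂ} {U : Set ℂ} (hU : IsOpen U)
    (hf : ∀ n, DifferentiableOn ℂ (f n) U)
    (hb : ∀ z ∈ U, ∃ V ∈ nhds z, ∃ u : ℕ → ℝ, Summable u ∧ ∀ n, ∀ w ∈ V, ‖f n w‖ ≤ u n) :
    AnalyticOnNhd ℂ (fun z => ∑' n, f n z) U := by
  refine DifferentiableOn.analyticOnNhd (fun z hz => ?_) hU
  obtain ⟨V, hV, u, hu, hle⟩ := hb z hz
  obtain ⟨W, hWV, hW, hzW⟩ := mem_nhds_iff.1 hV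
  exact ((Complex.differentiableOn_tsum_of_summable_norm hu
    (fun n => (hf n).mono (Set.inter_subset_right (s := W))) (hW.inter hU)
    fun n w hw => hle n w (hWV hw.1)).differentiableAt
      ((hW.inter hU).mem_nhds ⟨hzW, hz⟩)).differentiableWithinAt

theorem exists_prod_one_add_le {a : ℕ → ℝ} (ha : ∀ n, 0 ≤ a n) (hs : Summable a) :
    ∃ K, 0 < K ∧ ∀ n, ∏ j ∈ Finset.range n, (1 + a j) ≤ K := by
  refine ⟨Real.exp (∑' n, a n), Real.exp_pos _, fun n => ?_⟩
  calc ∏ j ∈ Finset.range n, (1 + a j) ≤ ∏ j ∈ Finset.range n, Real.exp (a j) :=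
        Finset.prod_le_prod (fun j _ => by linarith [ha j]) fun j _ => by
          rw [add_comm]; exact Real.add_one_le_exp _
    _ = Real.exp (∑ j ∈ Finset.range n, a j) := (Real.exp_sum _ _).symm
    _ ≤ _ := Real.exp_le_exp.2 (hs.sum_le_tsum _ fun j _ => ha j)

/-- Write 1/(1 - a) = 1 + a/(1 - a). As a/(1 - a) ≤ 2a eventually, the upper bound for products of 1
+ b applies to the inverse. -/
theorem exists_le_prod_one_sub {a : ℕ → ℝ} (ha : ∀ n, 0 ≤ a n) (ha1 : ∀ n, a n < 1)
    (hs : Summable a) : ∃ c, 0 < c ∧ ∀ n, c ≤ ∏ j ∈ Finset.range n, (1 - a j) := by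
  have h1 : ∀ n, 0 < 1 - a n := fun n => sub_pos.2 (ha1 n)
  have hs' : Summable fun n => a n / (1 - a n) := by
    refine (hs.mul_left 2).of_norm_bounded_eventually_nat ?_
    filter_upwards [hs.tendsto_atTop_zero.eventually_lt_const (show (0 : ℝ) < 1 / 2 by norm_num)]
      with n hn
    rw [Real.norm_of_nonneg (div_nonneg (ha n) (h1 n).le), div_le_iff₀ (h1 n)]
    nlinarith [ha n]
  obtain ⟨K, hK, hle⟩ := exists_prod_one_add_le (fun n => div_nonneg (ha n) (h1 n).le) hs'
  refine ⟨K⁻¹, inv_pos.2 hK, fun n => ?_⟩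
  have h2 : ∏ j ∈ Finset.range n, (1 - a j) = (∏ j ∈ Finset.range n, (1 + a j / (1 - a j)))⁻¹ := by
    rw [← Finset.prod_inv_distrib]
    refine Finset.prod_congr rfl fun j _ => ?_
    have := (h1 j).ne'
    field_simp
    ring
  rw [h2]
  exact inv_anti₀ (Finset.prod_pos fun j _ => by have := div_nonneg (ha j) (h1 j).le; linarith)
    (hle n)

/-! ### The limit of the reversed polynomials under geometric decay. -/

section Decay

variable {α : ℕ → ℂ} {ρ₀ : ℝ}

theorem GeometricDecay.summable_norm (h : GeometricDecay α ρ₀) (h0 : 0 ≤ ρ₀) (h1 : ρ₀ < 1) :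
    Summable fun n => ‖α n‖ := by
  obtain ⟨ρ, hρ, hρ1⟩ := exists_between h1
  obtain ⟨C, -, hle⟩ := h ρ hρ
  exact Summable.of_nonneg_of_le (fun n => norm_nonneg _) hle
    ((summable_geometric_of_lt_one (h0.trans hρ.le) hρ1).mul_left C)

theorem GeometricDecay.exists_norm_szego_le (h : GeometricDecay α ρ₀) (h0 : 0 ≤ ρ₀)
    (h1 : ρ₀ < 1) : ∃ K, 0 < K ∧ ∀ (n : ℕ) (z : ℂ) (s : ℝ), 1 ≤ s → ‖z‖ ≤ s →
      ‖(szegoPoly α n).eval z‖ ≤ K * s ^ n ∧ ‖(szegoRev α n).eval z‖ ≤ K * s ^ n := by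
  obtain ⟨K, hK, hle⟩ := exists_prod_one_add_le (fun n => norm_nonneg (α n))
    (h.summable_norm h0 h1)
  refine ⟨K, hK, fun n z s hs hz => ?_⟩
  have hm := mul_le_mul_of_nonneg_right (hle n) (pow_nonneg (zero_le_one.trans hs) n)
  exact ⟨(norm_szego_le α n hs hz).1.trans hm, (norm_szego_le α n hs hz).2.trans hm⟩

theorem GeometricDecay.exists_norm_step_le (h : GeometricDecay α ρ₀) (h0 : 0 ≤ ρ₀)
    (h1 : ρ₀ < 1) {ρ s : ℝ} (hρ : ρ₀ < ρ) (hs : 1 ≤ s) : ∃ K, 0 ≤ K ∧ ∀ (n : ℕ) (z : ℂ), ‖z‖ ≤ s →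
      ‖α n * (z * (szegoPoly α n).eval z)‖ ≤ K * (ρ * s) ^ n := by
  obtain ⟨K, hK, hle⟩ := h.exists_norm_szego_le h0 h1
  obtain ⟨C, hC, hα⟩ := h ρ hρ
  refine ⟨C * (s * K), by positivity, fun n z hz => ?_⟩
  rw [norm_mul, norm_mul]
  calc ‖α n‖ * (‖z‖ * ‖(szegoPoly α n).eval z‖) ≤ (C * ρ ^ n) * (s * (K * s ^ n)) := by
        have := (hle n z s hs hz).1
        have := hα n
        gcongr
        exact (norm_nonneg _).trans this
    _ = C * (s * K) * (ρ * s) ^ n := by rw [mul_pow]; ring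

theorem sum_range_pow_le {a : ℝ} (ha : 0 ≤ a) (n : ℕ) :
    ∑ j ∈ Finset.range n, a ^ j ≤ n * max 1 a ^ n := by
  calc ∑ j ∈ Finset.range n, a ^ j ≤ ∑ j ∈ Finset.range n, max 1 a ^ n :=
        Finset.sum_le_sum fun j hj => (pow_le_pow_left₀ ha (le_max_right _ _) j).trans
          (pow_le_pow_right₀ (le_max_left _ _) (Finset.mem_range.1 hj).le)
    _ = _ := by simp

/-- Obtained by summing the telescoped series termwise. Replacing the crude s^n by max(1, ρs)^n
gains the extra factor ρ^n that moves the final radius from R² to R³. -/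
theorem GeometricDecay.exists_norm_szegoRev_le (h : GeometricDecay α ρ₀) (h0 : 0 ≤ ρ₀)
    (h1 : ρ₀ < 1) {ρ s : ℝ} (hρ : ρ₀ < ρ) (hs : 1 ≤ s) : ∃ K, 0 ≤ K ∧ ∀ (n : ℕ) (z : ℂ), ‖z‖ ≤ s →
      ‖(szegoRev α n).eval z‖ ≤ K * ((n + 1) * max 1 (ρ * s) ^ n) := by
  obtain ⟨K, hK, hle⟩ := h.exists_norm_step_le h0 h1 hρ hs
  have hρs : 0 ≤ ρ * s := mul_nonneg (h0.trans hρ.le) (zero_le_one.trans hs)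
  refine ⟨1 + K, by positivity, fun n z hz => ?_⟩
  have hM : 1 ≤ max 1 (ρ * s) ^ n := one_le_pow₀ (le_max_left _ _)
  have hsum : ‖∑ j ∈ Finset.range n, α j * (z * (szegoPoly α j).eval z)‖ ≤
      K * (n * max 1 (ρ * s) ^ n) := by
    refine (norm_sum_le_of_le _ fun j _ => hle j z hz).trans ?_
    rw [← Finset.mul_sum]
    exact mul_le_mul_of_nonneg_left (sum_range_pow_le hρs n) hK
  rw [eval_szegoRev_eq_sum]
  refine (norm_sub_le _ _).trans ?_
  rw [norm_one]
  have hn : (0 : ℝ) ≤ n := n.cast_nonneg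
  nlinarith [mul_nonneg hn (zero_le_one.trans hM), mul_nonneg hK (zero_le_one.trans hM)]

/-- The limit `D(0) / D(z)` of the reversed polynomials `Φ_n^*`. -/
noncomputable def szegoLimit (α : ℕ → ℂ) (z : ℂ) : ℂ :=
  1 - ∑' n, α n * (z * (szegoPoly α n).eval z)

@[simp] theorem szegoLimit_zero : szegoLimit α 0 = 1 := by simp [szegoLimit]

theorem isOpen_mul_norm_lt_one (a : ℝ) : IsOpen {z : ℂ | a * ‖z‖ < 1} :=
  isOpen_lt (continuous_const.mul continuous_norm) continuous_const

theorem GeometricDecay.exists_locally_summable (h : GeometricDecay α ρ₀) (h0 : 0 ≤ ρ₀)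
    (h1 : ρ₀ < 1) {z : ℂ} (hz : ρ₀ * ‖z‖ < 1) : ∃ V ∈ nhds z, ∃ u : ℕ → ℝ, Summable u ∧
      ∀ n, ∀ w ∈ V, ‖α n * (w * (szegoPoly α n).eval w)‖ ≤ u n := by
  -- The bounds on Φ_n need a radius s ≥ 1, whence the maximum with 1.
  have hm : ρ₀ * max 1 ‖z‖ < 1 := by
    rcases max_choice 1 ‖z‖ with hh | hh <;> rw [hh] <;> linarith
  obtain ⟨s, hs, hs1⟩ := exists_gt_mul_lt_one hm
  rw [mul_comm] at hs1
  obtain ⟨ρ, hρ, hρs⟩ := exists_gt_mul_lt_one hs1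
  rw [mul_comm] at hρs
  have h1s : 1 ≤ s := (le_max_left _ _).trans hs.le
  obtain ⟨K, -, hle⟩ := h.exists_norm_step_le h0 h1 hρ h1s
  refine ⟨{w | ‖w‖ < s}, (isOpen_lt continuous_norm continuous_const).mem_nhds
    ((le_max_right _ _).trans_lt hs), _, (summable_geometric_of_lt_one
    (mul_nonneg (h0.trans hρ.le) (zero_le_one.trans h1s)) hρs).mul_left K,
    fun n w hw => hle n w (le_of_lt hw)⟩

theorem GeometricDecay.analyticOnNhd_szegoLimit (h : GeometricDecay α ρ₀) (h0 : 0 ≤ ρ₀)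
    (h1 : ρ₀ < 1) : AnalyticOnNhd ℂ (szegoLimit α) {z | ρ₀ * ‖z‖ < 1} := by
  refine analyticOnNhd_const.sub (analyticOnNhd_tsum_of_locally_bounded
    (isOpen_mul_norm_lt_one _) (fun n => ?_) fun z hz => h.exists_locally_summable h0 h1 hz)
  exact ((differentiable_const _).mul
    (differentiable_id.mul (szegoPoly α n).differentiable)).differentiableOn

theorem GeometricDecay.tendsto_szegoRev (h : GeometricDecay α ρ₀) (h0 : 0 ≤ ρ₀)
    (h1 : ρ₀ < 1) {z : ℂ} (hz : ρ₀ * ‖z‖ < 1) :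
    Tendsto (fun n => (szegoRev α n).eval z) atTop (nhds (szegoLimit α z)) := by
  obtain ⟨V, hV, u, hu, hle⟩ := h.exists_locally_summable h0 h1 hz
  simp_rw [eval_szegoRev_eq_sum]
  exact tendsto_const_nhds.sub
    (hu.of_norm_bounded fun n => hle n z (mem_of_mem_nhds hV)).hasSum.tendsto_sum_nat

theorem GeometricDecay.szegoLimit_ne_zero (h : GeometricDecay α ρ₀) (h0 : 0 ≤ ρ₀)
    (h1 : ρ₀ < 1) (hα : ∀ n, ‖α n‖ < 1) {z : ℂ} (hz : ‖z‖ ≤ 1) : szegoLimit α z ≠ 0 := by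
  obtain ⟨c, hc, hle⟩ := exists_le_prod_one_sub (fun n => norm_nonneg (α n)) hα
    (h.summable_norm h0 h1)
  have ht := (h.tendsto_szegoRev h0 h1 (z := z) (by nlinarith [norm_nonneg z])).norm
  have := ge_of_tendsto' ht fun n =>
    (hle n).trans (prod_le_norm_szegoRev α (fun n => (hα n).le) hz n)
  exact norm_pos_iff.1 (hc.trans_le this)

end Decay

/-! ### Orthogonality in the limit and the weight of μ. -/

section Weight

variable {μ : Measure Circle} [IsFiniteMeasure μ] {ρ₀ : ℝ}

theorem GeometricDecay.continuous_szegoLimit_circle {α : ℕ → ℂ} (h : GeometricDecay α ρ₀)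
    (h0 : 0 ≤ ρ₀) (h1 : ρ₀ < 1) : Continuous fun z : Circle => szegoLimit α (z : ℂ) :=
  (h.analyticOnNhd_szegoLimit h0 h1).continuousOn.comp_continuous continuous_coe_circle
    fun z => by
      rw [Set.mem_ofPred_eq, Circle.norm_coe, mul_one]
      exact h1

theorem GeometricDecay.tendsto_integral {α : ℕ → ℂ} (h : GeometricDecay α ρ₀)
    (h0 : 0 ≤ ρ₀) (h1 : ρ₀ < 1) {g : Circle → ℂ} (hg : Continuous g) :
    Tendsto (fun n => ∫ z : Circle, g z * (szegoRev α n).eval (z : ℂ) ∂μ) atTop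
      (nhds (∫ z : Circle, g z * szegoLimit α (z : ℂ) ∂μ)) := by
  obtain ⟨K, hK, hle⟩ := h.exists_norm_szego_le h0 h1
  refine tendsto_integral_of_dominated_convergence (fun z => ‖g z‖ * K) (fun n => ?_)
    ((hg.norm.mul continuous_const).integrable_circle μ) (fun n => ?_) ?_
  · exact (hg.mul ((szegoRev α n).continuous.comp continuous_coe_circle)).aestronglyMeasurable
  · refine Eventually.of_forall fun z => ?_
    rw [norm_mul]
    have := (hle n z 1 le_rfl (Circle.norm_coe z).le).2
    rw [one_pow, mul_one] at this
    gcongr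
  · exact Eventually.of_forall fun z =>
      tendsto_const_nhds.mul (h.tendsto_szegoRev h0 h1 (by rw [Circle.norm_coe, mul_one]; exact h1))

theorem integral_szegoLimit_mul_zpow (hμ : IsNontrivialMeasure μ)
    (h : GeometricDecay (verblunsky μ) ρ₀) (h0 : 0 ≤ ρ₀) (h1 : ρ₀ < 1) {k : ℕ} (hk : 1 ≤ k) :
    ∫ z : Circle, szegoLimit (verblunsky μ) (z : ℂ) * (z : ℂ) ^ (-(k : ℤ)) ∂μ = 0 := by
  have ht := h.tendsto_integral h0 h1 (μ := μ) (g := fun z : Circle => (z : ℂ) ^ (-(k : ℤ)))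
    (continuous_coe_circle.zpow₀ _ fun z => Or.inl z.coe_ne_zero)
  simp_rw [mul_comm ((_ : ℂ) ^ (-(k : ℤ)))] at ht
  refine tendsto_nhds_unique ht (tendsto_const_nhds.congr' ?_)
  filter_upwards [eventually_ge_atTop k] with n hn
  exact (integral_szegoRev_mul_zpow hμ hk hn).symm

/-- G z^{-k} is orthogonal to every z^j with j ≥ 0, hence to every Φ_n^*. Letting n tend to infinity
replaces conj Φ_n^* by conj G. -/
theorem integral_norm_sq_szegoLimit_mul_zpow (hμ : IsNontrivialMeasure μ)
    (h : GeometricDecay (verblunsky μ) ρ₀) (h0 : 0 ≤ ρ₀) (h1 : ρ₀ < 1) {k : ℕ} (hk : 1 ≤ k) :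
    ∫ z : Circle, ((‖szegoLimit (verblunsky μ) (z : ℂ)‖ ^ 2 : ℝ) : ℂ) *
      (z : ℂ) ^ (-(k : ℤ)) ∂μ = 0 := by
  set G := fun z : Circle => szegoLimit (verblunsky μ) (z : ℂ) with hG
  have hGc : Continuous G := h.continuous_szegoLimit_circle h0 h1
  have hzc : ∀ k : ℤ, Continuous fun z : Circle => (z : ℂ) ^ k := fun k =>
    continuous_coe_circle.zpow₀ _ fun z => Or.inl z.coe_ne_zero
  have hn : ∀ n : ℕ, ∫ z : Circle, (G z * (z : ℂ) ^ (-(k : ℤ))) *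
      conj ((szegoRev (verblunsky μ) n).eval (z : ℂ)) ∂μ = 0 := fun n => by
    have hGz : Continuous fun z : Circle => G z * (z : ℂ) ^ (-(k : ℤ)) := hGc.mul (hzc _)
    rw [integral_mul_conj_eval hGz (natDegree_szego_le _ n).2,
      integral_szegoLimit_mul_zpow hμ h h0 h1 hk, mul_zero]
    intro j _ _
    rw [← integral_szegoLimit_mul_zpow hμ h h0 h1 (k := k + j) (by omega)]
    refine integral_congr_ae (Eventually.of_forall fun z => ?_)
    simp only [hG]
    rw [mul_assoc, ← zpow_add₀ z.coe_ne_zero]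
    congr 2
    push_cast
    ring
  have ht := h.tendsto_integral h0 h1 (μ := μ)
    (g := fun z : Circle => conj (G z * (z : ℂ) ^ (-(k : ℤ))))
    (Complex.continuous_conj.comp (hGc.mul (hzc _)))
  have hz : ∀ n : ℕ, ∫ z : Circle, conj (G z * (z : ℂ) ^ (-(k : ℤ))) *
      (szegoRev (verblunsky μ) n).eval (z : ℂ) ∂μ = 0 := fun n => by
    rw [← map_eq_zero (starRingEnd ℂ), ← integral_conj, ← hn n]
    simp
  simp_rw [hz] at ht
  have h2 := tendsto_nhds_unique ht tendsto_const_nhds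
  rw [← map_eq_zero (starRingEnd ℂ), ← integral_conj] at h2
  rw [← h2]
  refine integral_congr_ae (Eventually.of_forall fun z => ?_)
  simp only [map_mul, Complex.conj_conj, hG]
  rw [mul_right_comm, Complex.mul_conj, Complex.normSq_eq_norm_sq]

theorem weight_ae_eq_szegoLimit (hμ : IsNontrivialMeasure μ)
    (h : GeometricDecay (verblunsky μ) ρ₀) (h0 : 0 ≤ ρ₀) (h1 : ρ₀ < 1) :
    ∃ κ : ℝ, 0 < κ ∧ weight μ =ᵐ[arcMeasure] fun ζ =>
      κ / ‖szegoLimit (verblunsky μ) (ζ : ℂ)‖ ^ 2 := by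
  have hne : ∀ ζ : Circle, szegoLimit (verblunsky μ) (ζ : ℂ) ≠ 0 := fun ζ =>
    h.szegoLimit_ne_zero h0 h1 (norm_verblunsky_lt_one hμ) (Circle.norm_coe ζ).le
  have hc := h.continuous_szegoLimit_circle h0 h1
  refine ⟨_, ?_, weight_ae_eq_div_norm_sq hc hne
    fun k => integral_norm_sq_szegoLimit_mul_zpow hμ h h0 h1⟩
  have hc2 : Continuous fun z : Circle => ‖szegoLimit (verblunsky μ) (z : ℂ)‖ ^ 2 := hc.norm.pow 2
  -- Here κ is the integral of |G|². It is positive because G has no zeros on the circle and μ ≠ 0,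
  -- the latter being nontriviality for the empty set.
  rw [integral_pos_iff_support_of_nonneg (fun z => by positivity) (hc2.integrable_circle μ)]
  have hsupp : Function.support (fun z : Circle => ‖szegoLimit (verblunsky μ) (z : ℂ)‖ ^ 2) =
      Set.univ := by
    ext z
    simpa using hne z
  rw [hsupp, pos_iff_ne_zero]
  simpa using hμ ∅ Set.finite_empty

end Weight

/-! ### The Schwarz integral formula and the Szegő function -/

/-- A nonvanishing holomorphic function on a disc has a holomorphic logarithm. -/
theorem exists_log_of_ne_zero_on_ball {G : ℂ → ℂ} {r : ℝ} (hr : 0 < r)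
    (hG : DifferentiableOn ℂ G (Metric.ball 0 r)) (hG0 : ∀ z ∈ Metric.ball (0 : ℂ) r, G z ≠ 0)
    (h1 : G 0 = 1) : ∃ L : ℂ → ℂ, L 0 = 0 ∧ DifferentiableOn ℂ L (Metric.ball 0 r) ∧
      ∀ z ∈ Metric.ball (0 : ℂ) r, Complex.exp (L z) = G z := by
  have hd : DifferentiableOn ℂ (fun z => deriv G z / G z) (Metric.ball 0 r) :=
    (hG.deriv Metric.isOpen_ball).div hG hG0
  obtain ⟨L, hL0, hL⟩ := hd.isExactOn_ball.with_val_at 0 0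
  refine ⟨L, hL0, fun z hz => (hL z hz).differentiableAt.differentiableWithinAt, fun z hz => ?_⟩
  -- `L` is a primitive of G'/G, so G exp(-L) is constant.
  have hder : ∀ w ∈ Metric.ball (0 : ℂ) r,
      HasDerivAt (fun w => G w * Complex.exp (-L w)) 0 w := fun w hw => by
    have h := ((hG.differentiableAt (Metric.isOpen_ball.mem_nhds hw)).hasDerivAt).mul
      (hL w hw).neg.cexp
    refine h.congr_deriv ?_
    have := hG0 w hw
    field_simp
    ring
  have hc := Metric.isOpen_ball.is_const_of_deriv_eq_zero
    (convex_ball (0 : ℂ) r).isPreconnected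
    (fun w hw => (hder w hw).differentiableAt.differentiableWithinAt)
    (fun w hw => (hder w hw).deriv) hz (Metric.mem_ball_self hr)
  simp only [hL0, h1, neg_zero, Complex.exp_zero, mul_one] at hc
  rw [Complex.exp_neg] at hc
  exact (eq_of_mul_inv_eq_one hc).symm

/-- The **Schwarz integral formula** on the unit disc. -/
theorem circleAverage_re_mul_schwarz_kernel {L : ℂ → ℂ} {r : ℝ} (hr : 1 < r)
    (hL : DifferentiableOn ℂ L (Metric.ball 0 r)) {z : ℂ} (hz : ‖z‖ < 1) :
    Real.circleAverage (fun ζ => ((L ζ).re : ℂ) * ((ζ + z) / (ζ - z))) 0 1 =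
      L z - (L 0).im * Complex.I := by
  have hsub : Metric.closedBall (0 : ℂ) 1 ⊆ Metric.ball 0 r := Metric.closedBall_subset_ball hr
  have hz' : z ∈ Metric.ball (0 : ℂ) |1| := by simpa using hz
  have hcl : ∀ f : ℂ → ℂ, DifferentiableOn ℂ f (Metric.closedBall 0 1) →
      DiffContOnCl ℂ f (Metric.ball 0 |1|) := fun f hf => by
    rw [abs_one]
    exact hf.diffContOnCl_ball subset_rfl
  have hLc : DifferentiableOn ℂ L (Metric.closedBall 0 1) := hL.mono hsub
  have hsph : ∀ ζ ∈ Metric.sphere (0 : ℂ) |1|, ‖ζ‖ = 1 ∧ ζ - z ≠ 0 ∧ 1 - conj z * ζ ≠ 0 ∧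
      ζ ≠ 0 ∧ conj ζ = ζ⁻¹ := by
    intro ζ hζ
    have hn : ‖ζ‖ = 1 := by simpa using hζ
    have h0 : ζ ≠ 0 := norm_pos_iff.1 (by rw [hn]; exact one_pos)
    refine ⟨hn, fun h => ?_, fun h => ?_, h0, ?_⟩
    · rw [sub_eq_zero.1 h] at hn
      linarith
    · have h2 : ‖conj z * ζ‖ = 1 := by rw [← sub_eq_zero.1 h, norm_one]
      rw [norm_mul, hn, RCLike.norm_conj] at h2
      linarith
    · rw [Complex.inv_def, Complex.normSq_eq_norm_sq, hn]
      simp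
  have hcont : ∀ f : ℂ → ℂ, ContinuousOn f (Metric.sphere 0 |1|) → CircleIntegrable f 0 1 :=
    fun f hf => ContinuousOn.circleIntegrable' hf
  have hLs : ContinuousOn L (Metric.sphere 0 |1|) :=
    hLc.continuousOn.mono (by rw [abs_one]; exact Metric.sphere_subset_closedBall)
  have hk : ContinuousOn (fun ζ : ℂ => (ζ - 0) / (ζ - z)) (Metric.sphere 0 |1|) :=
    (continuousOn_id.sub continuousOn_const).div (continuousOn_id.sub continuousOn_const)
      fun ζ hζ => (hsph ζ hζ).2.1
  -- On the circle conj ζ = ζ⁻¹, so conj M = conj L · (ζ + z)/(ζ - z). As `M` is holomorphic on the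
  -- closed disc, the antiholomorphic half of Re L has the mean value conj M(0)/2 = conj L(0)/2.
  set M : ℂ → ℂ := fun ζ => L ζ * ((1 + conj z * ζ) / (1 - conj z * ζ)) with hM
  have hMd : DifferentiableOn ℂ M (Metric.closedBall 0 1) := by
    refine hLc.mul (DifferentiableOn.div (by fun_prop) (by fun_prop) fun ζ hζ h => ?_)
    have h2 : ‖conj z * ζ‖ = 1 := by rw [← sub_eq_zero.1 h, norm_one]
    rw [norm_mul, RCLike.norm_conj] at h2
    have h3 : ‖ζ‖ ≤ 1 := by simpa using hζ
    nlinarith [norm_nonneg z, norm_nonneg ζ]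
  have hMs : ContinuousOn M (Metric.sphere 0 |1|) :=
    hMd.continuousOn.mono (by rw [abs_one]; exact Metric.sphere_subset_closedBall)
  have e1 := (hcl L hLc).circleAverage_smul_div hz'
  have e2 := (hcl L hLc).circleAverage
  have e3 := (hcl M hMd).circleAverage
  have e4 : Real.circleAverage (fun ζ => conj (M ζ)) 0 1 = conj (Real.circleAverage M 0 1) :=
    (Complex.conjCLE : ℂ →L[ℝ] ℂ).circleAverage_comp_comm (hcont M hMs)
  -- From (ζ + z)/(ζ - z) = 2ζ/(ζ - z) - 1, the holomorphic half is a Cauchy kernel term minus L/2.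
  have hpt : Set.EqOn (fun ζ => ((L ζ).re : ℂ) * ((ζ + z) / (ζ - z)))
      (fun ζ => ((ζ - 0) / (ζ - z)) • L ζ + ((-(1 / 2) : ℂ) • L ζ + (1 / 2 : ℂ) • conj (M ζ)))
      (Metric.sphere 0 |1|) := by
    intro ζ hζ
    obtain ⟨-, h1, h2, h3, h4⟩ := hsph ζ hζ
    have h5 : ((L ζ).re : ℂ) = (L ζ + conj (L ζ)) / 2 := by
      rw [Complex.add_conj]; push_cast; ring
    have h6 : conj (M ζ) = conj (L ζ) * ((ζ + z) / (ζ - z)) := by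
      simp only [hM, map_mul, map_div₀, map_add, map_sub, map_one, Complex.conj_conj, h4]
      congr 1
      rw [div_eq_div_iff _ h1]
      · field_simp
      · intro h
        apply h1
        have : ζ - z = (1 - z * ζ⁻¹) * ζ := by field_simp
        rw [this, h, zero_mul]
    simp only [smul_eq_mul]
    rw [h5, h6]
    field_simp
    ring
  rw [Real.circleAverage_congr_sphere hpt]
  have i1 : CircleIntegrable (fun ζ => ((ζ - 0) / (ζ - z)) • L ζ) 0 1 := hcont _ (hk.smul hLs)
  have i2 : CircleIntegrable (fun ζ => (-(1 / 2) : ℂ) • L ζ) 0 1 :=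
    hcont _ (hLs.const_smul (-(1 / 2) : ℂ))
  have i3 : CircleIntegrable (fun ζ => (1 / 2 : ℂ) • conj (M ζ)) 0 1 :=
    hcont _ ((Complex.continuous_conj.comp_continuousOn hMs).const_smul (1 / 2 : ℂ))
  have i4 : CircleIntegrable (fun ζ => (-(1 / 2) : ℂ) • L ζ + (1 / 2 : ℂ) • conj (M ζ)) 0 1 :=
    i2.add i3
  have s1 : Real.circleAverage (fun ζ => ((ζ - 0) / (ζ - z)) • L ζ +
      ((-(1 / 2) : ℂ) • L ζ + (1 / 2 : ℂ) • conj (M ζ))) 0 1 =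
      L z + ((-(1 / 2) : ℂ) • L 0 + (1 / 2 : ℂ) • conj (M 0)) := by
    rw [Real.circleAverage_fun_add i1 i4, Real.circleAverage_fun_add i2 i3,
      Real.circleAverage_fun_smul, Real.circleAverage_fun_smul]
    rw [e1, e2, e4, e3]
  rw [s1]
  simp only [hM, mul_zero, add_zero, sub_zero, div_one, mul_one, smul_eq_mul]
  have := Complex.sub_conj (L 0)
  push_cast at this
  linear_combination (-(1 / 2) : ℂ) * this

/-- The Szegő function of a measure with weight `κ |G|⁻²`, where `G` is holomorphic and nonvanishing
near the closed unit disc, is `√κ / G`. -/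
theorem szegoFunction_eq_div {μ : Measure Circle} {G : ℂ → ℂ} {κ r : ℝ} (hκ : 0 < κ) (hr : 1 < r)
    (hG : DifferentiableOn ℂ G (Metric.ball 0 r)) (hG0 : ∀ z ∈ Metric.ball (0 : ℂ) r, G z ≠ 0)
    (h1 : G 0 = 1) (hw : weight μ =ᵐ[arcMeasure] fun ζ => κ / ‖G (ζ : ℂ)‖ ^ 2) {z : ℂ}
    (hz : ‖z‖ < 1) : szegoFunction μ z = (Real.sqrt κ : ℂ) / G z := by
  obtain ⟨L, hL0, hL, hexp⟩ := exists_log_of_ne_zero_on_ball (zero_lt_one.trans hr) hG hG0 h1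
  -- Re M = log(κ/|G|²) is log w almost everywhere on the circle, M(0) is real, and exp(M/2) = √κ/G.
  -- The 1/2 is what 1/(4π) leaves after the averaging factor 1/(2π).
  set M : ℂ → ℂ := fun ζ => (Real.log κ : ℂ) - 2 * L ζ with hM
  have hMd : DifferentiableOn ℂ M (Metric.ball 0 r) :=
    (differentiableOn_const _).sub ((differentiableOn_const _).mul hL)
  have hS := circleAverage_re_mul_schwarz_kernel hr hMd hz
  rw [circleAverage_zero_one_eq] at hS
  have hint : ∫ θ in (0 : ℝ)..(2 * Real.pi), (Real.log (weight μ (Circle.exp θ)) : ℂ) *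
      (((Circle.exp θ : ℂ) + z) / ((Circle.exp θ : ℂ) - z)) =
      ∫ θ in (0 : ℝ)..(2 * Real.pi), ((M (Circle.exp θ)).re : ℂ) *
      (((Circle.exp θ : ℂ) + z) / ((Circle.exp θ : ℂ) - z)) := by
    refine intervalIntegral.integral_congr_ae ?_
    rw [Set.uIoc_of_le Real.two_pi_pos.le]
    refine (ae_restrict_iff' measurableSet_Ioc).1 ?_
    filter_upwards [ae_restrict_of_ae_arcMeasure hw] with θ hθ
    have hb : (Circle.exp θ : ℂ) ∈ Metric.ball (0 : ℂ) r := by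
      rw [mem_ball_zero_iff, Circle.norm_coe]
      exact hr
    rw [hθ, ← hexp _ hb, Complex.norm_exp, Real.log_div hκ.ne' (by positivity), Real.log_pow,
      Real.log_exp]
    simp [hM]
  have hzb : z ∈ Metric.ball (0 : ℂ) r := by
    rw [mem_ball_zero_iff]
    linarith
  have hpi : (Real.pi : ℂ) ≠ 0 := by exact_mod_cast Real.pi_ne_zero
  have hcoef : (1 / (4 * (Real.pi : ℂ))) = 1 / 2 * (2 * (Real.pi : ℂ))⁻¹ := by
    field_simp
    norm_num
  rw [szegoFunction, hint, hcoef, mul_assoc, hS, ← hexp z hzb]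
  have hM0 : (M 0).im = 0 := by simp [hM, hL0]
  rw [hM0, Complex.ofReal_zero, zero_mul, sub_zero, Real.sqrt_eq_rpow, Real.rpow_def_of_pos hκ,
    Complex.ofReal_exp, ← Complex.exp_sub]
  congr 1
  simp only [hM]
  push_cast
  ring

theorem szegoCondition_of_weight {μ : Measure Circle} {g : Circle → ℝ} (hg : Continuous g)
    (hpos : ∀ ζ, 0 < g ζ) (hw : weight μ =ᵐ[arcMeasure] g) : SzegoCondition μ := by
  refine ⟨?_, ?_⟩
  · filter_upwards [hw] with ζ hζ
    rw [hζ]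
    exact hpos ζ
  · have hc : Continuous fun ζ => Real.log (g ζ) := hg.log fun ζ => (hpos ζ).ne'
    refine (hc.integrable_circle arcMeasure).congr ?_
    filter_upwards [hw] with ζ hζ
    rw [hζ]

/-! ### The remainder -/

section Remainder

variable {α : ℕ → ℂ} {ρ₀ : ℝ}

theorem GeometricDecay.exists_locally_summable_power (h : GeometricDecay α ρ₀) (h0 : 0 ≤ ρ₀)
    {z : ℂ} (hz : ρ₀ * ‖z‖ < 1) : ∃ V ∈ nhds z, ∃ u : ℕ → ℝ, Summable u ∧
      ∀ n, ∀ w ∈ V, ‖α n * w ^ (n + 1)‖ ≤ u n := by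
  obtain ⟨s, hs, hs1⟩ := exists_gt_mul_lt_one hz
  rw [mul_comm] at hs1
  obtain ⟨ρ, hρ, hρs⟩ := exists_gt_mul_lt_one hs1
  rw [mul_comm] at hρs
  have hs0 : 0 < s := (norm_nonneg z).trans_lt hs
  have hρ0 : 0 < ρ := h0.trans_lt hρ
  obtain ⟨C, hC, hle⟩ := h ρ hρ
  refine ⟨{w | ‖w‖ < s}, (isOpen_lt continuous_norm continuous_const).mem_nhds hs, _,
    (summable_geometric_of_lt_one (mul_nonneg hρ0.le hs0.le) hρs).mul_left (C * s),
    fun n w hw => ?_⟩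
  rw [norm_mul, norm_pow]
  calc ‖α n‖ * ‖w‖ ^ (n + 1) ≤ (C * ρ ^ n) * s ^ (n + 1) :=
        mul_le_mul (hle n) (pow_le_pow_left₀ (norm_nonneg _) (le_of_lt hw) _) (by positivity)
          (by positivity)
    _ = C * s * (ρ * s) ^ n := by rw [mul_pow]; ring

theorem GeometricDecay.summable_power (h : GeometricDecay α ρ₀) (h0 : 0 ≤ ρ₀) {z : ℂ}
    (hz : ρ₀ * ‖z‖ < 1) : Summable fun n => α n * z ^ (n + 1) := by
  obtain ⟨V, hV, u, hu, hle⟩ := h.exists_locally_summable_power h0 hz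
  exact hu.of_norm_bounded fun n => hle n z (mem_of_mem_nhds hV)

theorem GeometricDecay.analyticOnNhd_power (h : GeometricDecay α ρ₀) (h0 : 0 ≤ ρ₀) :
    AnalyticOnNhd ℂ (fun z => ∑' n, α n * z ^ (n + 1)) {z | ρ₀ * ‖z‖ < 1} :=
  analyticOnNhd_tsum_of_locally_bounded (isOpen_mul_norm_lt_one _)
    (fun n => by fun_prop) fun _ hz => h.exists_locally_summable_power h0 hz

/-- The terms of the series for `G(z) - S(z) G♯(z)`. -/
noncomputable def szegoRemainderTerm (α : ℕ → ℂ) (m : ℕ) (z : ℂ) : ℂ :=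
  (∑ j ∈ Finset.range (m + 1), α j * z ^ (j + 1)) *
    (conj (α m) * ((z ^ (m + 1))⁻¹ * (szegoRev α m).eval z))

/-- The function `G(z) - S(z) G♯(z)`, where `G` is the limit of `Φ_n^*` and
`G♯(z) = conj (G (1 / conj z))`. -/
noncomputable def szegoRemainder (α : ℕ → ℂ) (z : ℂ) : ℂ := 1 - ∑' m, szegoRemainderTerm α m z

/-- Up to factors m + 1, the ratio collects max(1, ρt)/t from the partial sum times z^{-m-1}, ρ from
α_m, and max(1, ρs) from Φ_m^*. -/
theorem GeometricDecay.exists_norm_remainderTerm_le (h : GeometricDecay α ρ₀) (h0 : 0 ≤ ρ₀)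
    (h1 : ρ₀ < 1) {ρ s t : ℝ} (hρ : ρ₀ < ρ) (hs : 1 ≤ s) (ht : 0 < t) :
    ∃ K, ∀ (m : ℕ) (z : ℂ), t ≤ ‖z‖ → ‖z‖ ≤ s → ‖szegoRemainderTerm α m z‖ ≤
      K * (((m : ℝ) + 1) ^ 2 * (ρ / t * max 1 (ρ * t) * max 1 (ρ * s)) ^ m) := by
  obtain ⟨K, hK, hle⟩ := h.exists_norm_szegoRev_le h0 h1 hρ hs
  obtain ⟨C, hC, hα⟩ := h ρ hρ
  have hρ0 : 0 < ρ := h0.trans_lt hρ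
  refine ⟨C * C * K * max 1 (ρ * t), fun m z htz hzs => ?_⟩
  have hz0 : 0 < ‖z‖ := ht.trans_le htz
  -- The inverse power is absorbed first: the remaining exponent j - m is nonpositive, so only the
  -- lower bound t on |z| enters.
  have hpow : ∀ j ∈ Finset.range (m + 1), ‖α j * z ^ (j + 1)‖ * (‖z‖ ^ (m + 1))⁻¹ ≤
      C * (t ^ m)⁻¹ * (ρ * t) ^ j := by
    intro j hj
    have hjm : j ≤ m := Nat.lt_succ_iff.1 (Finset.mem_range.1 hj)
    have e1 : ‖z‖ ^ (j + 1) * (‖z‖ ^ (m + 1))⁻¹ = (‖z‖ ^ (m - j))⁻¹ := by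
      rw [show ‖z‖ ^ (m + 1) = ‖z‖ ^ (m - j) * ‖z‖ ^ (j + 1) by rw [← pow_add]; congr 1; omega]
      field_simp
    have e2 : (t ^ (m - j))⁻¹ = (t ^ m)⁻¹ * t ^ j := by
      conv_rhs => rw [← Nat.sub_add_cancel hjm, pow_add]
      field_simp
    have e3 : (‖z‖ ^ (m - j))⁻¹ ≤ (t ^ (m - j))⁻¹ :=
      inv_anti₀ (by positivity) (pow_le_pow_left₀ ht.le htz _)
    rw [norm_mul, norm_pow, mul_assoc, e1]
    calc ‖α j‖ * (‖z‖ ^ (m - j))⁻¹ ≤ (C * ρ ^ j) * (t ^ (m - j))⁻¹ :=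
          mul_le_mul (hα j) e3 (by positivity) (by positivity)
      _ = _ := by rw [e2, mul_pow]; ring
  have hsum : ‖∑ j ∈ Finset.range (m + 1), α j * z ^ (j + 1)‖ * (‖z‖ ^ (m + 1))⁻¹ ≤
      C * (t ^ m)⁻¹ * ((m + 1) * max 1 (ρ * t) ^ (m + 1)) := by
    calc _ ≤ (∑ j ∈ Finset.range (m + 1), ‖α j * z ^ (j + 1)‖) * (‖z‖ ^ (m + 1))⁻¹ := by
          gcongr
          exact norm_sum_le _ _
      _ ≤ ∑ j ∈ Finset.range (m + 1), C * (t ^ m)⁻¹ * (ρ * t) ^ j := by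
          rw [Finset.sum_mul]
          exact Finset.sum_le_sum hpow
      _ ≤ _ := by
          rw [← Finset.mul_sum]
          have := sum_range_pow_le (a := ρ * t) (by positivity) (m + 1)
          push_cast at this
          gcongr
  calc ‖szegoRemainderTerm α m z‖
      = (‖∑ j ∈ Finset.range (m + 1), α j * z ^ (j + 1)‖ * (‖z‖ ^ (m + 1))⁻¹) *
          (‖α m‖ * ‖(szegoRev α m).eval z‖) := by
        rw [szegoRemainderTerm, norm_mul, norm_mul, norm_mul, norm_inv, norm_pow,
          RCLike.norm_conj]
        ring
    _ ≤ (C * (t ^ m)⁻¹ * ((m + 1) * max 1 (ρ * t) ^ (m + 1))) *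
          ((C * ρ ^ m) * (K * ((m + 1) * max 1 (ρ * s) ^ m))) := by
        refine mul_le_mul hsum (mul_le_mul (hα m) (hle m z hzs) (norm_nonneg _) (by positivity))
          (by positivity) (by positivity)
    _ = _ := by
        rw [mul_pow, mul_pow, div_pow, pow_succ (max 1 (ρ * t))]
        ring

theorem summable_succ_sq_mul_pow {q : ℝ} (hq0 : 0 ≤ q) (hq : q < 1) :
    Summable fun m : ℕ => ((m : ℝ) + 1) ^ 2 * q ^ m := by
  have hq' : ‖q‖ < 1 := by rwa [Real.norm_of_nonneg hq0]
  have h2 := summable_pow_mul_geometric_of_norm_lt_one 2 hq'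
  have h1 := summable_pow_mul_geometric_of_norm_lt_one 1 hq'
  refine ((h2.add (h1.mul_left 2)).add (summable_geometric_of_lt_one hq0 hq)).congr fun m => ?_
  ring

/-- At ρ = ρ₀, t = x, s = max(1, x) the ratio is ρ₀/x if ρ₀x ≤ 1 and ρ₀³x otherwise, both less than
1. Continuity leaves room for a small perturbation ε. -/
theorem exists_remainder_radii {ρ₀ x : ℝ} (h0 : 0 ≤ ρ₀) (h1 : ρ₀ < 1) (hx : ρ₀ < x)
    (hx3 : ρ₀ ^ 3 * x < 1) : ∃ ρ s t : ℝ, ρ₀ < ρ ∧ 1 ≤ s ∧ 0 < t ∧ t < x ∧ x < s ∧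
      ρ / t * max 1 (ρ * t) * max 1 (ρ * s) < 1 := by
  have hx0 : 0 < x := h0.trans_lt hx
  have hq : (ρ₀ + 0) / (x - 0) * max 1 ((ρ₀ + 0) * (x - 0)) *
      max 1 ((ρ₀ + 0) * (max 1 x + 0)) < 1 := by
    simp only [add_zero, sub_zero]
    rcases le_or_gt (ρ₀ * x) 1 with hle | hgt
    · have h2 : ρ₀ * max 1 x ≤ 1 := by
        rcases max_choice 1 x with hh | hh <;> rw [hh] <;> linarith
      rw [max_eq_left hle, max_eq_left h2, mul_one, mul_one, div_lt_one hx0]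
      exact hx
    · have h2 : 1 ≤ x := by nlinarith
      rw [max_eq_right h2, max_eq_right hgt.le]
      have : ρ₀ / x * (ρ₀ * x) * (ρ₀ * x) = ρ₀ ^ 3 * x := by field_simp
      rwa [this]
  have hc : ContinuousAt (fun ε : ℝ => (ρ₀ + ε) / (x - ε) * max 1 ((ρ₀ + ε) * (x - ε)) *
      max 1 ((ρ₀ + ε) * (max 1 x + ε))) 0 := by
    have hd : ContinuousAt (fun ε : ℝ => (ρ₀ + ε) / (x - ε)) 0 :=
      ContinuousAt.div (by fun_prop) (by fun_prop) (by simpa using hx0.ne')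
    exact (hd.mul (by fun_prop)).mul (by fun_prop)
  have hev : ∀ᶠ ε in nhdsWithin (0 : ℝ) (Set.Ioi 0), (ρ₀ + ε) / (x - ε) *
      max 1 ((ρ₀ + ε) * (x - ε)) * max 1 ((ρ₀ + ε) * (max 1 x + ε)) < 1 :=
    nhdsWithin_le_nhds (hc.eventually_lt_const hq)
  have hev2 : ∀ᶠ ε in nhdsWithin (0 : ℝ) (Set.Ioi 0), ε < x :=
    nhdsWithin_le_nhds (eventually_lt_nhds hx0)
  obtain ⟨ε, ⟨hε1, hε2⟩, hε⟩ := ((hev.and hev2).and self_mem_nhdsWithin).exists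
  have hε0 : 0 < ε := hε
  exact ⟨ρ₀ + ε, max 1 x + ε, x - ε, by linarith, by linarith [le_max_left 1 x], by linarith,
    by linarith, by linarith [le_max_right 1 x], hε1⟩

theorem GeometricDecay.exists_locally_summable_remainder (h : GeometricDecay α ρ₀) (h0 : 0 ≤ ρ₀)
    (h1 : ρ₀ < 1) {z : ℂ} (hz : ρ₀ < ‖z‖) (hz3 : ρ₀ ^ 3 * ‖z‖ < 1) :
    ∃ V ∈ nhds z, ∃ u : ℕ → ℝ, Summable u ∧ ∀ n, ∀ w ∈ V, ‖szegoRemainderTerm α n w‖ ≤ u n := by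
  obtain ⟨ρ, s, t, hρ, hs, ht, htx, hxs, hq⟩ := exists_remainder_radii h0 h1 hz hz3
  obtain ⟨K, hle⟩ := h.exists_norm_remainderTerm_le h0 h1 hρ hs ht
  have hρ0 : 0 < ρ := h0.trans_lt hρ
  refine ⟨{w | t < ‖w‖} ∩ {w | ‖w‖ < s}, ((isOpen_lt continuous_const continuous_norm).inter
    (isOpen_lt continuous_norm continuous_const)).mem_nhds ⟨htx, hxs⟩, _,
    (summable_succ_sq_mul_pow (by positivity) hq).mul_left K,
    fun n w hw => hle n w (le_of_lt hw.1) (le_of_lt hw.2)⟩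

theorem GeometricDecay.analyticOnNhd_szegoRemainder (h : GeometricDecay α ρ₀) (h0 : 0 ≤ ρ₀)
    (h1 : ρ₀ < 1) :
    AnalyticOnNhd ℂ (szegoRemainder α) {z | ρ₀ < ‖z‖ ∧ ρ₀ ^ 3 * ‖z‖ < 1} := by
  refine analyticOnNhd_const.sub (analyticOnNhd_tsum_of_locally_bounded
    ((isOpen_lt continuous_const continuous_norm).inter (isOpen_mul_norm_lt_one _))
    (fun n => ?_) fun z hz => h.exists_locally_summable_remainder h0 h1 hz.1 hz.2)
  intro z hz
  have hz0 : z ≠ 0 := norm_pos_iff.1 (h0.trans_lt hz.1)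
  have hinv : DifferentiableAt ℂ (fun z : ℂ => (z ^ (n + 1))⁻¹) z :=
    (differentiableAt_id.pow _).inv (pow_ne_zero _ hz0)
  have hsum : DifferentiableAt ℂ (fun z : ℂ => ∑ j ∈ Finset.range (n + 1), α j * z ^ (j + 1)) z := by
    fun_prop
  exact (hsum.mul ((differentiableAt_const _).mul
    (hinv.mul (szegoRev α n).differentiable.differentiableAt))).differentiableWithinAt

/-- The limit of `szegoRev_sub_eq_sum`. Both z and 1/conj z must lie in the disc of convergence, so
it holds only for ρ₀ < |z| < R, although the left side is analytic further out. -/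
theorem GeometricDecay.szegoRemainder_eq (h : GeometricDecay α ρ₀) (h0 : 0 ≤ ρ₀)
    (h1 : ρ₀ < 1) {z : ℂ} (hz : ρ₀ < ‖z‖) (hz1 : ρ₀ * ‖z‖ < 1) :
    szegoRemainder α z = szegoLimit α z + (∑' n, α n * z ^ (n + 1)) *
      conj (szegoLimit α (conj z)⁻¹) := by
  have hzp : 0 < ‖z‖ := h0.trans_lt hz
  have hz0 : z ≠ 0 := norm_pos_iff.1 hzp
  have hz3 : ρ₀ ^ 3 * ‖z‖ < 1 := by
    have : ρ₀ ^ 3 ≤ ρ₀ := by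
      calc ρ₀ ^ 3 ≤ ρ₀ ^ 1 := pow_le_pow_of_le_one h0 h1.le (by norm_num)
        _ = ρ₀ := pow_one _
    nlinarith
  have hzi : ρ₀ * ‖(conj z)⁻¹‖ < 1 := by
    rw [norm_inv, RCLike.norm_conj, ← div_eq_mul_inv, div_lt_one hzp]
    exact hz
  obtain ⟨V, hV, u, hu, hle⟩ := h.exists_locally_summable_remainder h0 h1 hz hz3
  have hT := (hu.of_norm_bounded fun n => hle n z (mem_of_mem_nhds hV)).hasSum.tendsto_sum_nat
  refine tendsto_nhds_unique (tendsto_const_nhds.sub hT) ?_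
  have hR := (h.tendsto_szegoRev h0 h1 hz1).add
    ((h.summable_power h0 hz1).hasSum.tendsto_sum_nat.mul
      ((Complex.continuous_conj.tendsto _).comp (h.tendsto_szegoRev h0 h1 hzi)))
  exact hR.congr fun n => szegoRev_sub_eq_sum α n hz0

end Remainder

/-! ### The main theorem -/

/-- With ρ₀ = 1/R the case R = ∞ becomes ρ₀ = 0 and needs no separate treatment. -/
theorem enorm_lt_iff_toReal_inv_mul_lt_one {A : ℝ≥0∞} (hA : A ≠ 0) (z : ℂ) :
    ‖z‖ₑ < A ↔ A⁻¹.toReal * ‖z‖ < 1 := by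
  rcases eq_or_ne A ∞ with rfl | hA'
  · simp
  have hp : 0 < A.toReal := ENNReal.toReal_pos hA hA'
  rw [ENNReal.toReal_inv, inv_mul_lt_iff₀ hp, mul_one, ← ofReal_norm,
    ENNReal.ofReal_lt_iff_lt_toReal (norm_nonneg _) hA']

theorem exists_ball_ne_zero {G : ℂ → ℂ} {ρ₀ : ℝ} (h0 : 0 ≤ ρ₀) (h1 : ρ₀ < 1)
    (hG : AnalyticOnNhd ℂ G {z | ρ₀ * ‖z‖ < 1}) (hG0 : ∀ z : ℂ, ‖z‖ ≤ 1 → G z ≠ 0) :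
    ∃ δ : ℝ, 0 < δ ∧ δ < 1 ∧ ρ₀ < 1 - δ ∧
      ∀ z ∈ Metric.ball (0 : ℂ) (1 - δ)⁻¹, ρ₀ * ‖z‖ < 1 ∧ G z ≠ 0 := by
  have hU : IsOpen ({z : ℂ | ρ₀ * ‖z‖ < 1} ∩ G ⁻¹' {0}ᶜ) :=
    hG.continuousOn.isOpen_inter_preimage (isOpen_mul_norm_lt_one _) isOpen_compl_singleton
  obtain ⟨ε, hε, hsub⟩ := (isCompact_closedBall (0 : ℂ) 1).exists_thickening_subset_open hU
    fun z hz => by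
      have hz' : ‖z‖ ≤ 1 := by simpa using hz
      exact ⟨by rw [Set.mem_ofPred_eq]; nlinarith [norm_nonneg z], hG0 z hz'⟩
  rw [thickening_closedBall hε zero_le_one] at hsub
  -- c = 1 - δ: above 1/(1 + ε) so that the disc of radius 1/c stays in the zero-free neighbourhood,
  -- and above ρ₀ so that the remainder series converges on |z| > c.
  obtain ⟨c, hc, hc1⟩ := exists_between (max_lt h1 (inv_lt_one_of_one_lt₀ (show 1 < 1 + ε by linarith)))
  have hc0 : 0 < c := (inv_pos.2 (by linarith)).trans ((le_max_right _ _).trans_lt hc)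
  refine ⟨1 - c, by linarith, by linarith, ?_, fun z hz => ?_⟩
  · rw [sub_sub_cancel]
    exact (le_max_left _ _).trans_lt hc
  · rw [sub_sub_cancel, mem_ball_zero_iff] at hz
    refine hsub (mem_ball_zero_iff.2 (hz.trans ?_))
    rw [add_comm]
    exact inv_lt_of_inv_lt₀ (by linarith) ((le_max_right _ _).trans_lt hc)

theorem analyticOnNhd_conj_comp_inv_conj {G : ℂ → ℂ} {r : ℝ} (hr : 0 < r)
    (hG : DifferentiableOn ℂ G (Metric.ball 0 r⁻¹)) :
    AnalyticOnNhd ℂ (fun z => conj (G (conj z)⁻¹)) {z | r < ‖z‖} := by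
  refine DifferentiableOn.analyticOnNhd (fun z hz => ?_)
    (isOpen_lt continuous_const continuous_norm)
  have hzr : r < ‖z‖ := hz
  have hz0 : z ≠ 0 := norm_pos_iff.1 (hr.trans hzr)
  have hin : conj z⁻¹ ∈ Metric.ball (0 : ℂ) r⁻¹ := by
    rw [mem_ball_zero_iff, RCLike.norm_conj, norm_inv]
    exact inv_strictAnti₀ hr hzr
  have h1 : DifferentiableAt ℂ (conj ∘ G ∘ conj) z⁻¹ := by
    rw [differentiableAt_conj_conj_iff]
    exact hG.differentiableAt (Metric.isOpen_ball.mem_nhds hin)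
  have h2 := h1.comp z (differentiableAt_inv hz0)
  refine DifferentiableAt.differentiableWithinAt (h2.congr_of_eventuallyEq ?_)
  exact Eventually.of_forall fun w => by simp [map_inv₀]

theorem mainTheorem4 (μ : Measure Circle) [IsFiniteMeasure μ] (hμ : IsNontrivialMeasure μ)
    (R : ℝ≥0∞)
    (hlim : limsup (fun n : ℕ => ‖verblunsky μ n‖ₑ ^ (1 / (n : ℝ))) atTop = R⁻¹)
    (hR : R⁻¹ < 1) :
    -- the Szegő condition holds, so that the Szegő function is meaningful
    SzegoCondition μ ∧
    -- `S` is analytic in `|z| < R`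
    (∀ z : ℂ, ‖z‖ₑ < R → Summable fun n : ℕ => verblunsky μ n * z ^ (n + 1)) ∧
    AnalyticOnNhd ℂ (verblunskySeries μ) {z | ‖z‖ₑ < R} ∧
    -- `E` is the analytic continuation of `1 / D_i` to `|z| < R`
    ∃ E : ℂ → ℂ, AnalyticOnNhd ℂ E {z | ‖z‖ₑ < R} ∧
      (∀ z : ℂ, ‖z‖ < 1 → E z = (szegoFunction μ z)⁻¹) ∧
      ∃ δ : ℝ, 0 < δ ∧ δ < 1 ∧
        -- `Di` is the analytic continuation of `D_i` to `|z| < 1 / (1 - δ)`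
        ∃ Di : ℂ → ℂ, AnalyticOnNhd ℂ Di {z | ‖z‖ < (1 - δ)⁻¹} ∧
          (∀ z : ℂ, ‖z‖ < 1 → Di z = szegoFunction μ z) ∧
          -- `conj (D_i (1 / conj z)) / D_i z - S z` is analytic in `1 - δ < |z| < R ^ 3`
          ∃ F : ℂ → ℂ, AnalyticOnNhd ℂ F {z | 1 - δ < ‖z‖ ∧ ‖z‖ₑ < R ^ 3} ∧
            ∀ z : ℂ, 1 - δ < ‖z‖ → ‖z‖ₑ < R →
              F z = conj (Di (1 / conj z)) * E z - verblunskySeries μ z := by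
  set ρ₀ := R⁻¹.toReal with hρ₀
  have hRinv : R⁻¹ ≠ ∞ := (hR.trans ENNReal.one_lt_top).ne
  have hR0 : R ≠ 0 := fun h => hRinv (by rw [h, ENNReal.inv_zero])
  have h0 : 0 ≤ ρ₀ := ENNReal.toReal_nonneg
  have h1 : ρ₀ < 1 := by
    have := (ENNReal.toReal_lt_toReal hRinv ENNReal.one_ne_top).2 hR
    rwa [ENNReal.toReal_one] at this
  have hdisc : ∀ z : ℂ, ‖z‖ₑ < R ↔ ρ₀ * ‖z‖ < 1 := enorm_lt_iff_toReal_inv_mul_lt_one hR0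
  have hdisc3 : ∀ z : ℂ, ‖z‖ₑ < R ^ 3 ↔ ρ₀ ^ 3 * ‖z‖ < 1 := fun z => by
    rw [enorm_lt_iff_toReal_inv_mul_lt_one (pow_ne_zero 3 hR0), ENNReal.inv_pow,
      ENNReal.toReal_pow]
  simp only [hdisc, hdisc3]
  have hd : GeometricDecay (verblunsky μ) ρ₀ := geometricDecay_of_limsup hRinv hlim
  set G := szegoLimit (verblunsky μ) with hGdef
  have hG : AnalyticOnNhd ℂ G {z | ρ₀ * ‖z‖ < 1} := hd.analyticOnNhd_szegoLimit h0 h1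
  have hG0 : ∀ z : ℂ, ‖z‖ ≤ 1 → G z ≠ 0 := fun z hz =>
    hd.szegoLimit_ne_zero h0 h1 (norm_verblunsky_lt_one hμ) hz
  obtain ⟨κ, hκ, hw⟩ := weight_ae_eq_szegoLimit hμ hd h0 h1
  obtain ⟨δ, hδ0, hδ1, hδρ, hball⟩ := exists_ball_ne_zero h0 h1 hG hG0
  have hδp : 0 < 1 - δ := by linarith
  have hGb : DifferentiableOn ℂ G (Metric.ball 0 (1 - δ)⁻¹) := fun z hz =>
    (hG z (hball z hz).1).differentiableAt.differentiableWithinAt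
  have hD : ∀ z : ℂ, ‖z‖ < 1 → szegoFunction μ z = (Real.sqrt κ : ℂ) / G z := fun z hz =>
    szegoFunction_eq_div hκ ((one_lt_inv₀ hδp).2 (by linarith)) hGb (fun z hz => (hball z hz).2)
      szegoLimit_zero hw hz
  have hκ0 : (Real.sqrt κ : ℂ) ≠ 0 := by exact_mod_cast (Real.sqrt_pos.2 hκ).ne'
  have hGc : Continuous fun ζ : Circle => G (ζ : ℂ) := hd.continuous_szegoLimit_circle h0 h1
  have hnorm : ∀ ζ : Circle, 0 < ‖G (ζ : ℂ)‖ ^ 2 := fun ζ =>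
    pow_pos (norm_pos_iff.2 (hG0 _ (Circle.norm_coe ζ).le)) 2
  have hin : ∀ z : ℂ, 1 - δ < ‖z‖ → (conj z)⁻¹ ∈ Metric.ball (0 : ℂ) (1 - δ)⁻¹ := fun z hz => by
    rw [mem_ball_zero_iff, norm_inv, RCLike.norm_conj]
    exact inv_strictAnti₀ hδp hz
  have hGs0 : ∀ z : ℂ, 1 - δ < ‖z‖ → conj (G (conj z)⁻¹) ≠ 0 := fun z hz =>
    (map_ne_zero (starRingEnd ℂ)).2 (hball _ (hin z hz)).2
  -- The continuations are G/√κ for 1/D_i and √κ/G for D_i. In their product with reflection √κ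
  -- cancels, leaving G/G♯, and the remainder divided by G♯ is G/G♯ - S.
  refine ⟨szegoCondition_of_weight (continuous_const.div (hGc.norm.pow 2) fun ζ => (hnorm ζ).ne')
      (fun ζ => div_pos hκ (hnorm ζ)) hw, fun z hz => hd.summable_power h0 hz,
    (hd.analyticOnNhd_power h0).neg, fun z => G z / (Real.sqrt κ : ℂ),
    hG.div analyticOnNhd_const fun _ _ => hκ0, fun z hz => by rw [hD z hz, inv_div],
    δ, hδ0, hδ1, fun z => (Real.sqrt κ : ℂ) / G z,
    analyticOnNhd_const.div (fun z hz => hG z (hball z (mem_ball_zero_iff.2 hz)).1)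
      (fun z hz => (hball z (mem_ball_zero_iff.2 hz)).2), fun z hz => (hD z hz).symm,
    fun z => szegoRemainder (verblunsky μ) z / conj (G (conj z)⁻¹), ?_, fun z hz hz1 => ?_⟩
  · exact ((hd.analyticOnNhd_szegoRemainder h0 h1).mono fun z hz => ⟨hδρ.trans hz.1, hz.2⟩).div
      ((analyticOnNhd_conj_comp_inv_conj hδp hGb).mono fun z hz => hz.1) fun z hz => hGs0 z hz.1
  · have hne := hGs0 z hz
    simp only [one_div, hGdef] at hne ⊢
    rw [hd.szegoRemainder_eq h0 h1 (hδρ.trans hz) hz1, verblunskySeries, map_div₀,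
      Complex.conj_ofReal]
    generalize (∑' n, verblunsky μ n * z ^ (n + 1)) = S
    generalize conj (szegoLimit (verblunsky μ) (conj z)⁻¹) = a at hne ⊢
    field_simp
    ring
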